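/- **Theorem (Testing and Auditing from Agnostic Learning).** *Setting.* A set $\mathcal K$ of (measurable) functions $[0,1]\to[0,1]$ is a *valid post-processing class* if it contains the identity and, for all $\kappa\in\mathcal K$ and $s,t\in\mathbb R$, also contains $p\mapsto\bigl[\kappa([p+s]_0^1)+t\bigr]_0^1$, where $[\cdot]_0^1$ is projection onto $[0,1]$. Let $\mathsf{thr}(\mathcal K)=\{p\mapsto \mathrm{sign}_+(\kappa(p)-\tfrac12):\kappa\in\mathcal K\}$, where $\mathrm{sign}_+(t)=+1$ for $t\ge 0$ and $-1$ for $t<0$. Let $\mathcal L^*$ be the class of proper losses $\ell:[0,1]\times\{0,1\}\to\mathbb R$ (that is, $\mathbb E_{y\sim\mathrm{Be}(q)}[\ell(p,y)-\ell(q,y)]\ge 0$ for all $p,q\in[0,1]$) with $|\ell(p,1)-\ell(p,0)|\le 1$ for all $p$. For a distribution $J$ of $(p,y)\in[0,1]\times\{0,1\}$ let $$\mathsf{CDL}_{\mathcal K}(J)=\sup_{\ell\in\mathcal L^*,\,\kappa\in\mathcal K}\mathbb E\bigl[\ell(p,y)-\ell(\kappa(p),y)\bigr],\qquad \mathsf{ECE}(J)=\mathbb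 E\bigl|\mathbb E[y-p\mid p]\bigr|.$$ A randomized algorithm that sees i.i.d. examples from an arbitrary unknown $J$ and outputs Accept or Reject is an *$(\alpha,\beta)$-auditor* (resp. *$(\alpha,\beta)$-tester*) for $\mathsf{CDL}_{\mathcal K}$ with failure probability $\delta$ if it outputs Reject with probability at least $1-\delta$ whenever $\mathsf{CDL}_{\mathcal K}(J)>\alpha$, and outputs Accept with probability at least $1-\delta$ whenever $\mathsf{ECE}(J)\le\beta/2$ (resp. whenever $\mathsf{CDL}_{\mathcal K}(J)\le\beta$). An *$\varepsilon$-agnostic learner* for a class $\mathcal C$ of functions $[0,1]\to\{\pm1\}$, with sample complexity $m$, is a (jointly measurable) randomized algorithm that, given $m$ i.i.d. examples from an arbitrary unknown distribution $D$ on $[0,1]\times\{\pm1\}$, outputs $h:[0,1]\to\{\pm1\}$ such that, with probability at least $0.9$, $\Pr_D[h(p)\ne z]\le\inf_{f\in\mathcal C}\Pr_D[f(p)\ne z]+\varepsilon$; it is *proper* if always $h\in\mathcal C$. *Statement.* There are absolute constants $C>0$ and $k\in\mathbb N$ such that for all $\alpha,\varepsilon,\delta\in(0,1)$ there is an oracle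 procedure, depending only on $\alpha,\varepsilon,\delta$, with the following properties. Write $L=\log\frac1{\varepsilon\delta}$. 1. The procedure makes at most $C\,\frac1\varepsilon\,L$ calls to a learner. The calls are non-adaptive: all are specified before any hypothesis is seen. Each call runs the learner on fresh independent examples from $J$ whose labels $y$ are replaced by random signs, with probabilities (depending on $y$) chosen by the procedure. 2. It uses at most $C\,\frac1{\varepsilon^2}\,L$ additional examples from $J$. 3. It performs at most $C\,\frac{L}{\varepsilon^3}\log^k\!\bigl(2+\frac{L}{\varepsilon^3}\bigr)$ additional operations, i.e. $\tilde O(L/\varepsilon^3)$. These are unit-cost instructions on real registers: loading a constant or a coordinate of an additional example, addition, subtraction, multiplication, comparison, and evaluation of a returned hypothesis at a point. For each choice of $\alpha,\varepsilon,\delta$ they form a straight-line program. Running the learner and drawing and randomly labelling its examples belong to the calls. 4. For every valid post-processing class $\mathcal K$, every $m$, and every $\varepsilon$-agnostic learner for $\mathsf{thr}(\mathcal K)$ with sample complexity $m$, the procedure run with this learner is an $(\alpha,\alpha-3\varepsilon)$-auditor for $\mathsf{CDL}_{\mathcal K}$ with failure probability $\delta$. If moreover the learner is proper, the procedure is an $(\alpha,\alpha-3\varepsilon)$-tester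 for $\mathsf{CDL}_{\mathcal K}$ with failure probability $\delta$. -/

import Mathlib

universe u

open MeasureTheory

namespace CalDec

noncomputable section

/-! Predictions are points of the unit interval. Outcomes `y ∈ {0, 1}` and signs `z ∈ {-1, +1}` are
both stored as Booleans: `true` is the outcome `1`, respectively the sign `+1`. -/

/-- The outcome `y ∈ {0, 1}` as a real number. -/
def outcome (y : Bool) : ℝ := if y then 1 else 0

/-- The sign `z ∈ {-1, +1}` as a real number. -/
def signVal (z : Bool) : ℝ := if z then 1 else -1

/-- `sign₊ t`, which is `+1` if `t ≥ 0` and `-1` if `t < 0`. -/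
def signPlus (t : ℝ) : Bool := if 0 ≤ t then true else false

/-- The expectation of `g y` for `y ∼ Be(q)`. -/
def bernoulliMean (q : unitInterval) (g : Bool → ℝ) : ℝ :=
  (q : ℝ) * g true + (1 - (q : ℝ)) * g false

/-- The class `𝓛*`: proper losses `ℓ : [0,1] × {0,1} → ℝ` with `|ℓ(p,1) - ℓ(p,0)| ≤ 1`. -/
def properLosses : Set (unitInterval → Bool → ℝ) :=
  {l | (∀ p q : unitInterval, 0 ≤ bernoulliMean q (fun y => l p y - l q y)) ∧
    ∀ p : unitInterval, |l p true - l p false| ≤ 1}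

/-- Valid post-processing classes: they contain the identity, and are invariant under translations
of either axis, truncated to `[0,1]`. -/
structure IsValidClass (K : Set (unitInterval → unitInterval)) : Prop where
  id_mem : (fun p => p) ∈ K
  translate_mem : ∀ κ ∈ K, ∀ s t : ℝ,
    (fun p : unitInterval => Set.projIcc (0 : ℝ) 1 zero_le_one
      ((κ (Set.projIcc (0 : ℝ) 1 zero_le_one ((p : ℝ) + s)) : ℝ) + t)) ∈ K

/-- The upper thresholds `thr(K) = {p ↦ sign₊(κ(p) - 1/2) : κ ∈ K}`. -/
def thr (K : Set (unitInterval → unitInterval)) : Set (unitInterval → Bool) :=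
  {f | ∃ κ ∈ K, f = fun p => signPlus ((κ p : ℝ) - 1 / 2)}

/-- The calibration decision loss: the supremum of `E[ℓ(p,y) - ℓ(κ(p),y)]` over `ℓ ∈ 𝓛*`, `κ ∈ K`.
All losses in `𝓛*` are automatically bounded and Borel measurable. -/
def CDL (K : Set (unitInterval → unitInterval)) (J : Measure (unitInterval × Bool)) : ℝ :=
  sSup {r | ∃ l ∈ properLosses, ∃ κ ∈ K, r = ∫ x, (l x.1 x.2 - l (κ x.1) x.2) ∂J}

/-- The expected calibration error `E|E[y - p | p]|`. -/
def ECE (J : Measure (unitInterval × Bool)) : ℝ :=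
  ∫ x, |condExp (MeasurableSpace.comap Prod.fst inferInstance) J
    (fun x : unitInterval × Bool => outcome x.2 - (x.1 : ℝ)) x| ∂J

/-! ### Learners -/

/-- A randomized learning algorithm that maps `m` labelled examples and an internal random seed
`ω ∼ P` to a hypothesis `[0,1] → {-1,+1}`, measurably in all arguments. -/
structure Learner.{v} (m : ℕ) where
  Ω : Type v
  [mΩ : MeasurableSpace Ω]
  P : Measure Ω
  [isProb : IsProbabilityMeasure P]
  run : (Fin m → unitInterval × Bool) → Ω → unitInterval → Bool
  measurable_run : Measurable
    (fun x : ((Fin m → unitInterval × Bool) × Ω) × unitInterval => run x.1.1 x.1.2 x.2)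

attribute [instance] Learner.mΩ Learner.isProb

/-- The error `Pr_{(p,z) ∼ D}[h(p) ≠ z]`. -/
def err (D : Measure (unitInterval × Bool)) (h : unitInterval → Bool) : ℝ :=
  D.real {x | h x.1 ≠ x.2}

/-- `ε`-agnostic learner for the class `F`: for every distribution `D` the error of the output is at
most `inf_{f ∈ F} err f + ε`, with probability at least `0.9` over the `m` i.i.d. examples and the
seed. -/
def Learner.IsAgnostic {m : ℕ} (AL : Learner m) (ε : ℝ) (F : Set (unitInterval → Bool)) : Prop :=
  ∀ D : Measure (unitInterval × Bool), IsProbabilityMeasure D →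
    9 / 10 ≤ ((Measure.pi fun _ : Fin m => D).prod AL.P).real
      {x | ∀ f ∈ F, err D (AL.run x.1 x.2) ≤ err D f + ε}

/-- The learner always outputs a member of the class. -/
def Learner.IsProper {m : ℕ} (AL : Learner m) (F : Set (unitInterval → Bool)) : Prop :=
  ∀ S ω, AL.run S ω ∈ F

/-! ### Procedures with non-adaptive calls to a learner

The model of computation has real registers `0, 1, 2, …`, all initially zero, and runs straight-line
programs; every instruction is one operation. -/

/-- Instructions of a program that has access to `n` examples and to `N` hypotheses. The first
argument is the register that receives the result. -/
inductive Instr (n N : ℕ) : Type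
  /-- load a constant -/
  | const (dst : ℕ) (c : ℝ)
  | add (dst a b : ℕ)
  | sub (dst a b : ℕ)
  | mul (dst a b : ℕ)
  /-- compare: the result is `1` if register `a` is at most register `b`, and `0` otherwise -/
  | le (dst a b : ℕ)
  /-- load the prediction `p` of the `i`-th example -/
  | prediction (dst : ℕ) (i : Fin n)
  /-- load the outcome `y` of the `i`-th example -/
  | outcome (dst : ℕ) (i : Fin n)
  /-- the value `±1` of the `j`-th hypothesis at the point in register `a` (truncated to `[0,1]`) -/
  | hyp (dst : ℕ) (j : Fin N) (a : ℕ)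

/-- The effect of an instruction on the registers `R`. -/
def Instr.exec {n N : ℕ} (x : Fin n → unitInterval × Bool) (h : Fin N → unitInterval → Bool)
    (R : ℕ → ℝ) : Instr n N → ℕ → ℝ
  | .const dst c => Function.update R dst c
  | .add dst a b => Function.update R dst (R a + R b)
  | .sub dst a b => Function.update R dst (R a - R b)
  | .mul dst a b => Function.update R dst (R a * R b)
  | .le dst a b => Function.update R dst (if R a ≤ R b then 1 else 0)
  | .prediction dst i => Function.update R dst ((x i).1 : ℝ)
  | .outcome dst i => Function.update R dst (CalDec.outcome (x i).2)
  | .hyp dst j a => Function.update R dst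
      (signVal (h j (Set.projIcc (0 : ℝ) 1 zero_le_one (R a))))

/-- The registers after running a program. -/
def runProgram {n N : ℕ} (x : Fin n → unitInterval × Bool) (h : Fin N → unitInterval → Bool)
    (prog : List (Instr n N)) (R : ℕ → ℝ) : ℕ → ℝ :=
  prog.foldl (fun R i => i.exec x h R) R

/-- A procedure with `calls` non-adaptive calls to a learner and `extra` additional examples.
The program `prepare`, which sees no hypothesis, computes the parameters of all calls; then all calls
are made; then `decide` runs on the same registers, with access to the returned hypotheses.

The `j`-th call runs the learner on fresh examples `(p, z)`: an example `(p, y)` of the unknown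
distribution is drawn, and `y` is replaced by a random sign `z`, which is `+1` with the probability
in register `prob j y`. -/
structure Procedure where
  extra : ℕ
  calls : ℕ
  prepare : List (Instr extra 0)
  prob : Fin calls → Bool → ℕ
  decide : List (Instr extra calls)

namespace Procedure

/-- The number of additional operations. -/
def ops (A : Procedure) : ℕ := A.prepare.length + A.decide.length

/-- The registers after the first program, on the additional examples `x`. -/
def prepared (A : Procedure) (x : Fin A.extra → unitInterval × Bool) : ℕ → ℝ :=
  runProgram x (fun j => j.elim0) A.prepare (fun _ => 0)

/-- The hypothesis returned by the `j`-th call, which receives the examples `(d i).1`, uniform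
random numbers `(d i).2` in `[0,1]` for drawing the signs, and the seed `ω`. -/
def answer (A : Procedure) {m : ℕ} (AL : Learner m) (x : Fin A.extra → unitInterval × Bool)
    (j : Fin A.calls) (d : Fin m → (unitInterval × Bool) × unitInterval) (ω : AL.Ω) :
    unitInterval → Bool :=
  AL.run (fun i => ((d i).1.1,
    if ((d i).2 : ℝ) < A.prepared x (A.prob j (d i).1.2) then true else false)) ω

/-- Everything random in a run: the additional examples and, for each call, the learner's examples
with the uniform random numbers that produce their signs, and the learner's seed. -/
abbrev Sample (A : Procedure) {m : ℕ} (AL : Learner m) : Type _ :=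
  (Fin A.extra → unitInterval × Bool) ×
    (Fin A.calls → (Fin m → (unitInterval × Bool) × unitInterval) × AL.Ω)

/-- The law of all random choices of a run (all of them independent) when examples come from `J`. -/
def law (A : Procedure) {m : ℕ} (AL : Learner m) (J : Measure (unitInterval × Bool)) :
    Measure (A.Sample AL) :=
  (Measure.pi fun _ : Fin A.extra => J).prod
    (Measure.pi fun _ : Fin A.calls =>
      (Measure.pi fun _ : Fin m => J.prod (volume : Measure unitInterval)).prod AL.P)

/-- The procedure outputs Accept if register `0` finally holds a positive number, and Reject
otherwise. -/
def Accepts (A : Procedure) {m : ℕ} (AL : Learner m) (s : A.Sample AL) : Prop :=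
  0 < runProgram s.1 (fun j => A.answer AL s.1 j (s.2 j).1 (s.2 j).2) A.decide (A.prepared s.1) 0

/-- With the learner `AL`, the procedure is an `(α, β)`-auditor for `CDL_K` with failure
probability at most `δ`. -/
def IsAuditor (A : Procedure) {m : ℕ} (AL : Learner m) (K : Set (unitInterval → unitInterval))
    (α β δ : ℝ) : Prop :=
  ∀ J : Measure (unitInterval × Bool), IsProbabilityMeasure J →
    (α < CDL K J → 1 - δ ≤ (A.law AL J).real {s | ¬ A.Accepts AL s}) ∧
    (ECE J ≤ β / 2 → 1 - δ ≤ (A.law AL J).real {s | A.Accepts AL s})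

/-- With the learner `AL`, the procedure is an `(α, β)`-tester for `CDL_K` with failure
probability at most `δ`. -/
def IsTester (A : Procedure) {m : ℕ} (AL : Learner m) (K : Set (unitInterval → unitInterval))
    (α β δ : ℝ) : Prop :=
  ∀ J : Measure (unitInterval × Bool), IsProbabilityMeasure J →
    (α < CDL K J → 1 - δ ≤ (A.law AL J).real {s | ¬ A.Accepts AL s}) ∧
    (CDL K J ≤ β → 1 - δ ≤ (A.law AL J).real {s | A.Accepts AL s})

end Procedure

end

end CalDec

/-! A proper loss is encoded, as far as its increments matter, by a convex function and a monotone
selection `g` of its subgradients with values in `[-1,1]`. Rounding `g` to finitely many levels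
writes it as an average of signs of half lines, so the increments of the loss are, up to arbitrarily
small error, averages of increments of threshold losses `-sign(p ≥ v)(y - v)`
(`exists_threshold_mixture`). Hence a large calibration decision loss forces a single `κ` and a
single threshold `w` at which thresholding `κ p` beats thresholding `p`
(`exists_gain_gt_of_lt_CDL`). Validity of the class puts the thresholded `κ` in `thr K`.

For fixed `v` the best decision correlates most with `y - v`. Replacing `y` by a random sign of mean
`y - v` makes this a classification problem, and an excess error of `ε` costs `2ε` of correlation
(`err_relabelled`, `callLaw_bad_le`). The learner is therefore called on a grid of `v` of mesh at
most `ε/12`. Its hypotheses are compared with threshold decisions whose cut-offs are the grid points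
and sampled predictions: the correlation is Lipschitz in `v`, but moving the cut-off costs the mass
of predictions in between, which the sampled candidates control by a quantile argument
(`exists_quantile`, `miss_bound`). Conversely, no hypothesis gains more than `2 ECE` over a
threshold, and a proper one gains at most `CDL K J` (`gain_le_ECE`, `gain_le_CDL_of_mem_thr`), so a
gain seen above `α - 21/8 ε` separates the two cases once all estimates are accurate.

With `ℓ = log (1/ε)`, one such batch uses order `ℓ/ε` calls and `ℓ/ε²` examples and errs with
probability at most `ε/4` (`batchFailure_le`). Among `2k` independent batches, at least `k` err with
probability at most `ε^k` (`majority_bound`), and `k` is about `log (1/δ) / ℓ`; so `kℓ ≤ L`, and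
calls and examples are linear in `L`. Each correlation is computed once per batch and stored, so the
operations number about `k ℓ²/ε³`, at most a constant times `L ℓ/ε³`. Batching is what makes this
linear in `log (1/δ)`: aiming at failure probability `δ` in one batch would make both the number of
hypotheses and the sample size grow with it. The program itself is compiled from arithmetic formulas
(`compile_spec`, `accepts_auditProcedure_iff`). -/

namespace CalDec

noncomputable section

section

/-! ### Proper losses as mixtures of threshold losses -/

open Classical in
/-- The function that is `+1` on `U` and `-1` off `U`. -/
def setSign (U : Set unitInterval) (p : unitInterval) : ℝ := if p ∈ U then 1 else -1

lemma abs_setSign (U : Set unitInterval) (p : unitInterval) : |setSign U p| = 1 := by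
  unfold setSign; split_ifs <;> simp

lemma setSign_le_one (U : Set unitInterval) (p : unitInterval) : setSign U p ≤ 1 := by
  unfold setSign; split_ifs <;> norm_num

lemma neg_one_le_setSign (U : Set unitInterval) (p : unitInterval) : -1 ≤ setSign U p := by
  unfold setSign; split_ifs <;> norm_num

lemma measurable_setSign {U : Set unitInterval} (hU : MeasurableSet U) :
    Measurable (setSign U) := by
  classical
  have : setSign U = fun p => if p ∈ U then (1 : ℝ) else -1 := by
    funext p; unfold setSign; congr
  rw [this]
  exact Measurable.ite hU measurable_const measurable_const

/-- `v` separates the complement of `U` from `U`. -/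
def Separates (v : unitInterval) (U : Set unitInterval) : Prop :=
  ∀ p, (p ∈ U → v ≤ p) ∧ (p ∉ U → p ≤ v)

lemma Separates.measurableSet {v : unitInterval} {U : Set unitInterval} (h : Separates v U) :
    MeasurableSet U := by
  by_cases hv : v ∈ U
  · have : U = Set.Ici v := by
      ext p
      refine ⟨fun hp => (h p).1 hp, fun hp => ?_⟩
      by_contra hpU
      exact hpU (le_antisymm ((h p).2 hpU) hp ▸ hv)
    rw [this]; exact measurableSet_Ici
  · have : U = Set.Ioi v := by
      ext p
      refine ⟨fun hp => lt_of_le_of_ne ((h p).1 hp) (fun e => hv (e ▸ hp)), fun hp => ?_⟩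
      by_contra hpU
      exact absurd hp (not_lt.2 ((h p).2 hpU))
    rw [this]; exact measurableSet_Ioi

/-- The sign of `U` at `q` agrees with the sign of `q - v`, so it is the best multiplier in
`[-1,1]`. This is both properness of threshold losses and the subgradient inequality for `|q - v|`.
-/
lemma Separates.sign_mul_le {v : unitInterval} {U : Set unitInterval} (h : Separates v U)
    (p q : unitInterval) :
    setSign U p * ((q : ℝ) - v) ≤ setSign U q * ((q : ℝ) - v) := by
  by_cases hq : q ∈ U
  · have h1 : (v : ℝ) ≤ q := (h q).1 hq
    have h2 : setSign U q = 1 := by simp [setSign, hq]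
    rw [h2]
    exact mul_le_mul_of_nonneg_right (setSign_le_one U p) (by linarith)
  · have h1 : (q : ℝ) ≤ v := (h q).2 hq
    have h2 : setSign U q = -1 := by simp [setSign, hq]
    rw [h2]
    exact mul_le_mul_of_nonpos_right (neg_one_le_setSign U p) (by linarith)

lemma separates_Ici (v : unitInterval) : Separates v (Set.Ici v) :=
  fun _ => ⟨fun h => h, fun h => (not_le.1 h).le⟩

lemma exists_separates {U : Set unitInterval} (hU : IsUpperSet U) : ∃ v, Separates v U := by
  -- The infimum is taken in the complete lattice `unitInterval`, so the empty set gets the value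
  -- `1`.
  refine ⟨sInf U, fun p => ⟨fun h => sInf_le h, fun h => le_sInf fun u hu => ?_⟩⟩
  by_contra hlt
  exact h (hU (not_le.1 hlt).le hu)

/-- `g` selects subgradients of `φ`. -/
def IsSubgradient (φ g : unitInterval → ℝ) : Prop :=
  ∀ p q : unitInterval, g p * ((q : ℝ) - p) ≤ φ q - φ p

/-- A discrete substitute for integrating the subgradients. On an equal partition of `[p,q]`,
increments of `φ₁` are bounded by `g₁` at right endpoints and those of `φ₂` from below by `g₂` at
left endpoints. Passing from right to left endpoints in `g₁` telescopes to at most `2(q-p)/n`, which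
vanishes in the limit. -/
lemma IsSubgradient.diff_le_of_le {φ₁ g₁ φ₂ g₂ : unitInterval → ℝ} (h₁ : IsSubgradient φ₁ g₁)
    (h₂ : IsSubgradient φ₂ g₂) {η : ℝ} (hη : ∀ p, g₁ p - g₂ p ≤ η) (hb : ∀ p, |g₁ p| ≤ 1)
    {p q : unitInterval} (hpq : p ≤ q) :
    (φ₁ q - φ₁ p) - (φ₂ q - φ₂ p) ≤ η * ((q : ℝ) - p) := by
  have hpq' : (p : ℝ) ≤ q := hpq
  have key : ∀ n : ℕ, 0 < n →
      (φ₁ q - φ₁ p) - (φ₂ q - φ₂ p) ≤ η * ((q : ℝ) - p) + 2 * ((q : ℝ) - p) / n := by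
    intro n hn
    have hn' : (0 : ℝ) < n := by exact_mod_cast hn
    let x : ℕ → unitInterval := fun i =>
      Set.projIcc (0 : ℝ) 1 zero_le_one ((p : ℝ) + ((q : ℝ) - p) * i / n)
    have hx : ∀ i ≤ n, (x i : ℝ) = (p : ℝ) + ((q : ℝ) - p) * i / n := by
      intro i hi
      have hi' : (i : ℝ) ≤ n := by exact_mod_cast hi
      have h0 : 0 ≤ ((q : ℝ) - p) * i / n := by
        apply div_nonneg _ hn'.le
        exact mul_nonneg (by linarith) (Nat.cast_nonneg _)
      have h1 : ((q : ℝ) - p) * i / n ≤ (q : ℝ) - p := by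
        rw [div_le_iff₀ hn']
        exact mul_le_mul_of_nonneg_left hi' (by linarith)
      have hp0 := p.2.1
      have hq1 := q.2.2
      simp only [x]
      rw [Set.projIcc_of_mem zero_le_one (⟨by linarith, by linarith⟩ :
        (p : ℝ) + ((q : ℝ) - p) * i / n ∈ Set.Icc (0 : ℝ) 1)]
    have hx0 : x 0 = p := Subtype.ext (by rw [hx 0 (Nat.zero_le _)]; simp)
    have hxn : x n = q := Subtype.ext (by rw [hx n le_rfl]; field_simp; ring)
    have hstep : ∀ i ∈ Finset.range n,
        ((φ₁ (x (i + 1)) - φ₂ (x (i + 1))) - (φ₁ (x i) - φ₂ (x i))) ≤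
          (g₁ (x (i + 1)) - g₁ (x i)) * (((q : ℝ) - p) / n) + η * (((q : ℝ) - p) / n) := by
      intro i hi
      have hi' := Finset.mem_range.1 hi
      have hd : (x (i + 1) : ℝ) - x i = ((q : ℝ) - p) / n := by
        rw [hx _ hi', hx _ hi'.le]; push_cast; field_simp; ring
      have hΔ : 0 ≤ ((q : ℝ) - p) / n := div_nonneg (by linarith) hn'.le
      have a := h₁ (x (i + 1)) (x i)
      have b := h₂ (x i) (x (i + 1))
      have hd' : (x i : ℝ) - x (i + 1) = -(((q : ℝ) - p) / n) := by rw [← hd]; ring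
      rw [hd'] at a
      rw [hd] at b
      have c := mul_le_mul_of_nonneg_right (hη (x i)) hΔ
      linarith
    have hsum := Finset.sum_le_sum hstep
    rw [Finset.sum_range_sub (fun i => φ₁ (x i) - φ₂ (x i)), Finset.sum_add_distrib,
      ← Finset.sum_mul, Finset.sum_range_sub (fun i => g₁ (x i)), Finset.sum_const,
      Finset.card_range, hx0, hxn, nsmul_eq_mul] at hsum
    have e1 : (n : ℝ) * (η * (((q : ℝ) - p) / n)) = η * ((q : ℝ) - p) := by field_simp
    have e2 : (g₁ q - g₁ p) * (((q : ℝ) - p) / n) ≤ 2 * ((q : ℝ) - p) / n := by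
      rw [mul_div_assoc]
      apply mul_le_mul_of_nonneg_right _ (div_nonneg (by linarith) hn'.le)
      have := abs_le.1 (hb q)
      have := abs_le.1 (hb p)
      linarith
    rw [e1] at hsum
    linarith
  have ht : Filter.Tendsto (fun n : ℕ => η * ((q : ℝ) - p) + 2 * ((q : ℝ) - p) / n)
      Filter.atTop (nhds (η * ((q : ℝ) - p) + 0)) :=
    tendsto_const_nhds.add (tendsto_const_div_atTop_nhds_zero_nat _)
  rw [add_zero] at ht
  exact ge_of_tendsto ht (Filter.eventually_atTop.2 ⟨1, fun n hn => key n hn⟩)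

lemma IsSubgradient.diff_le {φ₁ g₁ φ₂ g₂ : unitInterval → ℝ} (h₁ : IsSubgradient φ₁ g₁)
    (h₂ : IsSubgradient φ₂ g₂) {η : ℝ} (hη : ∀ p, |g₁ p - g₂ p| ≤ η) (hb₁ : ∀ p, |g₁ p| ≤ 1)
    (hb₂ : ∀ p, |g₂ p| ≤ 1) (p q : unitInterval) :
    (φ₁ q - φ₁ p) - (φ₂ q - φ₂ p) ≤ η := by
  have h0 : 0 ≤ η := (abs_nonneg _).trans (hη p)
  have hp := p.2
  have hq := q.2
  rcases le_total p q with h | h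
  · refine (h₁.diff_le_of_le h₂ (fun p => (abs_le.1 (hη p)).2) hb₁ h).trans ?_
    nlinarith [hp.1, hq.2]
  · have := h₂.diff_le_of_le h₁ (η := η) (fun p => by linarith [(abs_le.1 (hη p)).1]) hb₂ h
    have h2 : η * ((p : ℝ) - q) ≤ η := by nlinarith [hq.1, hp.2]
    linarith

/-- Properness makes the Bayes risk a minimum of functions affine in the outcome probability. Its
negative is thus convex, and the slope of the supporting line at `p` is `l p false - l p true`. -/
lemma isSubgradient_of_mem_properLosses {l : unitInterval → Bool → ℝ} (hl : l ∈ properLosses) :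
    IsSubgradient (fun p => -(bernoulliMean p (l p))) (fun p => l p false - l p true) := by
  intro p q
  have := hl.1 p q
  simp only [bernoulliMean] at this ⊢
  nlinarith

lemma properLosses.monotone {l : unitInterval → Bool → ℝ} (hl : l ∈ properLosses) :
    Monotone (fun p => l p false - l p true) := by
  intro p q hpq
  rcases hpq.eq_or_lt with rfl | hlt
  · exact le_rfl
  · have a := isSubgradient_of_mem_properLosses hl p q
    have b := isSubgradient_of_mem_properLosses hl q p
    have hlt' : (p : ℝ) < q := hlt
    simp only at a b ⊢
    by_contra hc
    push Not at hc
    nlinarith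

/-- The Savage representation `ℓ(p,y) = -φ(p) - g(p)(y-p)`, in difference form. -/
lemma properLosses.diff_eq (l : unitInterval → Bool → ℝ) (p k : unitInterval) (y : Bool) :
    l p y - l k y = (-(bernoulliMean k (l k)) - -(bernoulliMean p (l p))) +
      (l k false - l k true) * (outcome y - k) - (l p false - l p true) * (outcome y - p) := by
  cases y <;> simp [bernoulliMean, outcome] <;> ring

lemma card_filter_succ_le (x : ℝ) (m : ℕ) (hx0 : 0 ≤ x) (hxm : x ≤ m) :
    ((Finset.range m).filter (fun j : ℕ => ((j : ℝ) + 1) ≤ x)).card = ⌊x⌋₊ := by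
  have : (Finset.range m).filter (fun j : ℕ => ((j : ℝ) + 1) ≤ x) = Finset.range ⌊x⌋₊ := by
    ext j
    have e : ((j : ℝ) + 1 ≤ x) ↔ j + 1 ≤ ⌊x⌋₊ := by
      rw [Nat.le_floor_iff hx0]; push_cast; rfl
    have hfm : ⌊x⌋₊ ≤ m := Nat.floor_le_of_le hxm
    simp only [Finset.mem_filter, Finset.mem_range, e]
    omega
  rw [this, Finset.card_range]

lemma measurable_outcome : Measurable outcome := measurable_of_finite _

lemma outcome_nonneg (y : Bool) : 0 ≤ outcome y := by cases y <;> simp [outcome]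

lemma outcome_le_one (y : Bool) : outcome y ≤ 1 := by cases y <;> simp [outcome]

lemma abs_outcome_sub_le (y : Bool) (v : unitInterval) : |outcome y - v| ≤ 1 := by
  have h1 := v.2.1
  have h2 := v.2.2
  have := outcome_nonneg y
  have := outcome_le_one y
  rw [abs_le]
  constructor <;> linarith

/-- Up to a small error, the increments of a proper loss are an average of increments of threshold
losses. -/
lemma exists_threshold_mixture {l : unitInterval → Bool → ℝ} (hl : l ∈ properLosses) {m : ℕ}
    (hm : 0 < m) :
    ∃ (U : ℕ → Set unitInterval) (v : ℕ → unitInterval), (∀ j, Separates (v j) (U j)) ∧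
      ∀ p k y, l p y - l k y ≤ (∑ j ∈ Finset.range m,
        (setSign (U j) k - setSign (U j) p) * (outcome y - v j)) / m + 6 / m := by
  classical
  have hm' : (0 : ℝ) < m := by exact_mod_cast hm
  set g : unitInterval → ℝ := fun p => l p false - l p true with hg
  have hmono : Monotone g := properLosses.monotone hl
  have hgb : ∀ p, |g p| ≤ 1 := fun p => by
    have := hl.2 p; rw [abs_sub_comm] at this; exact this
  -- These are the superlevel sets of `g` at the levels `-1 + 2(j+1)/m`; they are half lines because
  -- `g` is monotone.
  let U : ℕ → Set unitInterval := fun j => {p | (j : ℝ) + 1 ≤ (g p + 1) * m / 2}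
  have hup : ∀ j, IsUpperSet (U j) := by
    intro j p q hpq hp
    have hp' : (j : ℝ) + 1 ≤ (g p + 1) * m / 2 := hp
    have := hmono hpq
    show (j : ℝ) + 1 ≤ (g q + 1) * m / 2
    refine hp'.trans ?_
    gcongr
  choose v hv using fun j => exists_separates (hup j)
  refine ⟨U, v, hv, ?_⟩
  let G : unitInterval → ℝ := fun p => (∑ j ∈ Finset.range m, setSign (U j) p) / m
  let Φ : unitInterval → ℝ := fun p =>
    (∑ j ∈ Finset.range m, setSign (U j) p * ((p : ℝ) - v j)) / m
  have hsub : IsSubgradient Φ G := by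
    intro p q
    have h1 : (∑ j ∈ Finset.range m, setSign (U j) p * ((q : ℝ) - v j)) / m ≤
        (∑ j ∈ Finset.range m, setSign (U j) q * ((q : ℝ) - v j)) / m :=
      div_le_div_of_nonneg_right (Finset.sum_le_sum fun j _ => (hv j).sign_mul_le p q) hm'.le
    have h2 : (∑ j ∈ Finset.range m, setSign (U j) p * ((q : ℝ) - v j)) / m =
        Φ p + G p * ((q : ℝ) - p) := by
      simp only [Φ, G]
      rw [div_mul_eq_mul_div, ← add_div, Finset.sum_mul, ← Finset.sum_add_distrib]
      congr 1
      exact Finset.sum_congr rfl fun j _ => by ring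
    have h3 : (∑ j ∈ Finset.range m, setSign (U j) q * ((q : ℝ) - v j)) / m = Φ q := rfl
    linarith
  -- Averaging the signs rounds `g` down to a multiple of `2/m` above `-1`: the number of levels
  -- reached is a floor.
  have hGg : ∀ p, |g p - G p| ≤ 2 / m := by
    intro p
    obtain ⟨hb1, hb2⟩ := abs_le.1 (hgb p)
    set x := (g p + 1) * m / 2 with hx
    have hx0 : 0 ≤ x := by
      have : 0 ≤ (g p + 1) * m := mul_nonneg (by linarith) hm'.le
      linarith
    have hxm : x ≤ m := by
      have : (g p + 1) * m ≤ 2 * m := mul_le_mul_of_nonneg_right (by linarith) hm'.le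
      linarith
    have hs : ∑ j ∈ Finset.range m, setSign (U j) p = 2 * (⌊x⌋₊ : ℝ) - m := by
      have : ∀ j ∈ Finset.range m, setSign (U j) p =
          2 * (if (j : ℝ) + 1 ≤ x then (1 : ℝ) else 0) - 1 := by
        intro j _
        by_cases h : (j : ℝ) + 1 ≤ x
        · have : p ∈ U j := h
          simp [setSign, this, h]; norm_num
        · have : p ∉ U j := h
          simp [setSign, this, h]
      rw [Finset.sum_congr rfl this, Finset.sum_sub_distrib, ← Finset.mul_sum, Finset.sum_boole,
        card_filter_succ_le x m hx0 hxm]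
      simp
    have hG : G p = (2 * (⌊x⌋₊ : ℝ) - m) / m := by simp only [G]; rw [hs]
    have hgx : g p = (2 * x - m) / m := by rw [hx]; field_simp; ring
    rw [hG, hgx, ← sub_div, abs_div, abs_of_pos hm']
    refine div_le_div_of_nonneg_right ?_ hm'.le
    have := Nat.floor_le hx0
    have := Nat.lt_floor_add_one x
    rw [abs_le]; constructor <;> linarith
  have hGb : ∀ p, |G p| ≤ 1 := by
    intro p
    simp only [G]
    rw [abs_div, abs_of_pos hm', div_le_one hm']
    refine (Finset.abs_sum_le_sum_abs _ _).trans ?_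
    simp [abs_setSign]
  intro p k y
  -- The error `6/m` has three equal parts: the increments of the convex functions, and the slope
  -- terms at `p` and at `k`.
  have key := (isSubgradient_of_mem_properLosses hl).diff_le hsub hGg hgb hGb p k
  have e : (∑ j ∈ Finset.range m,
        (setSign (U j) k - setSign (U j) p) * (outcome y - v j)) / m =
      (Φ k - Φ p) + G k * (outcome y - k) - G p * (outcome y - p) := by
    simp only [Φ, G]
    rw [div_mul_eq_mul_div, div_mul_eq_mul_div, ← sub_div, ← add_div, ← sub_div]
    congr 1
    rw [Finset.sum_mul, Finset.sum_mul, ← Finset.sum_sub_distrib, ← Finset.sum_add_distrib,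
      ← Finset.sum_sub_distrib]
    exact Finset.sum_congr rfl fun j _ => by ring
  have b : ∀ q : unitInterval, |(g q - G q) * (outcome y - q)| ≤ 2 / m := by
    intro q
    rw [abs_mul]
    calc _ ≤ 2 / (m : ℝ) * 1 := mul_le_mul (hGg q) (abs_outcome_sub_le y q) (abs_nonneg _) (by positivity)
      _ = _ := mul_one _
  have bk := (abs_le.1 (b k)).2
  have bp := (abs_le.1 (b p)).1
  have e6 : (6 : ℝ) / m = 2 / m + 2 / m + 2 / m := by ring
  rw [e, properLosses.diff_eq l p k y, e6]
  linarith

/-! ### Gains over thresholds and the calibration decision loss -/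

lemma integrable_mul_outcome_sub (J : Measure (unitInterval × Bool)) [IsFiniteMeasure J]
    {f : unitInterval × Bool → ℝ} (hf : Measurable f) {C : ℝ} (hC : ∀ x, |f x| ≤ C)
    (v : unitInterval) :
    Integrable (fun x => f x * (outcome x.2 - v)) J := by
  refine Integrable.of_bound ?_ C (Filter.Eventually.of_forall fun x => ?_)
  · exact (hf.mul ((measurable_outcome.comp measurable_snd).sub_const _)).aestronglyMeasurable
  · rw [Real.norm_eq_abs, abs_mul]
    calc _ ≤ C * 1 := mul_le_mul (hC x) (abs_outcome_sub_le _ _) (abs_nonneg _)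
            ((abs_nonneg _).trans (hC x))
      _ = C := mul_one C

/-- The gain of the decisions `f` over the threshold `w`, for the threshold loss at `v`. -/
def gain (J : Measure (unitInterval × Bool)) (f : unitInterval → ℝ) (U : Set unitInterval)
    (v : unitInterval) : ℝ :=
  ∫ x, (f x.1 - setSign U x.1) * (outcome x.2 - v) ∂J

lemma measurable_sign_sub {f : unitInterval → ℝ} (hf : Measurable f) {U : Set unitInterval}
    (hU : MeasurableSet U) :
    Measurable (fun x : unitInterval × Bool => f x.1 - setSign U x.1) :=
  (hf.comp measurable_fst).sub ((measurable_setSign hU).comp measurable_fst)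

lemma abs_sign_sub_le {f : unitInterval → ℝ} (hf : ∀ p, |f p| ≤ 1) (U : Set unitInterval)
    (p : unitInterval) : |f p - setSign U p| ≤ 2 := by
  have := abs_le.1 (hf p)
  have := setSign_le_one U p
  have := neg_one_le_setSign U p
  rw [abs_le]; constructor <;> linarith

/-- The integral is at most an average of gains plus `6/m`. Once `6/m` is below the excess over `c`,
some gain in the average exceeds `c`. -/
lemma exists_gain_gt_of_integral_gt (J : Measure (unitInterval × Bool)) [IsProbabilityMeasure J]
    {l : unitInterval → Bool → ℝ} (hl : l ∈ properLosses) {κ : unitInterval → unitInterval}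
    (hκ : Measurable κ) {c : ℝ} (hc : 0 ≤ c)
    (h : c < ∫ x, (l x.1 x.2 - l (κ x.1) x.2) ∂J) :
    ∃ U v, Separates v U ∧ c < gain J (fun p => setSign U (κ p)) U v := by
  by_cases hi : Integrable (fun x : unitInterval × Bool => l x.1 x.2 - l (κ x.1) x.2) J
  swap
  -- Without integrability the integral is `0` by convention, which contradicts `0 ≤ c`.
  · rw [integral_undef hi] at h; linarith
  obtain ⟨m, hm⟩ := exists_nat_gt (6 / (∫ x, (l x.1 x.2 - l (κ x.1) x.2) ∂J - c))
  have hpos : 0 < ∫ x, (l x.1 x.2 - l (κ x.1) x.2) ∂J - c := by linarith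
  have hm0 : (0 : ℝ) < m := lt_trans (by positivity) hm
  have hm1 : 6 / (m : ℝ) < ∫ x, (l x.1 x.2 - l (κ x.1) x.2) ∂J - c := by
    rw [div_lt_iff₀ hpos] at hm
    rw [div_lt_iff₀ hm0]; linarith
  obtain ⟨U, v, hUv, hb⟩ := exists_threshold_mixture hl (m := m) (by exact_mod_cast hm0)
  have hint : ∀ j, Integrable (fun x : unitInterval × Bool =>
      (setSign (U j) (κ x.1) - setSign (U j) x.1) * (outcome x.2 - v j)) J := fun j =>
    integrable_mul_outcome_sub J
      (measurable_sign_sub ((measurable_setSign (hUv j).measurableSet).comp hκ)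
        (hUv j).measurableSet)
      (fun x => abs_sign_sub_le (fun p => (abs_setSign _ _).le) _ _) _
  by_contra hno
  push Not at hno
  have h1 : ∫ x, (l x.1 x.2 - l (κ x.1) x.2) ∂J ≤
      ∫ x, ((∑ j ∈ Finset.range m,
        (setSign (U j) (κ x.1) - setSign (U j) x.1) * (outcome x.2 - v j)) / m + 6 / m) ∂J := by
    refine integral_mono hi ?_ fun x => hb _ _ _
    exact ((integrable_finsetSum _ fun j _ => hint j).div_const _).add (integrable_const _)
  rw [integral_add ((integrable_finsetSum _ fun j _ => hint j).div_const _) (integrable_const _),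
    integral_div, integral_finsetSum _ fun j _ => hint j] at h1
  have h2 : ∑ j ∈ Finset.range m, ∫ x : unitInterval × Bool,
      (setSign (U j) (κ x.1) - setSign (U j) x.1) * (outcome x.2 - v j) ∂J ≤ m * c := by
    refine (Finset.sum_le_sum fun j _ => hno (U j) (v j) (hUv j)).trans ?_
    simp
  have h3 := div_le_div_of_nonneg_right h2 hm0.le
  rw [mul_div_cancel_left₀ _ hm0.ne'] at h3
  simp only [integral_const, probReal_univ, one_smul] at h1
  linarith

/-- A large gain for some upper set yields a large gain for a closed half line. -/
lemma exists_closed_gain_gt (J : Measure (unitInterval × Bool)) [IsProbabilityMeasure J]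
    {κ : unitInterval → unitInterval} (hκ : Measurable κ) {c : ℝ} (hc : 0 ≤ c)
    {U : Set unitInterval} {v : unitInterval} (hUv : Separates v U)
    (h : c < gain J (fun p => setSign U (κ p)) U v) :
    ∃ w, c < gain J (fun p => setSign (Set.Ici w) (κ p)) (Set.Ici w) w := by
  by_cases hv : v ∈ U
  · have : U = Set.Ici v := by
      ext p
      refine ⟨fun hp => (hUv p).1 hp, fun hp => ?_⟩
      by_contra hpU
      exact hpU (le_antisymm ((hUv p).2 hpU) hp ▸ hv)
    exact ⟨v, this ▸ h⟩
  -- Here `U` is the open half line above `v`. It is approximated by closed half lines starting at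
  -- `w n > v` with `w n → v`, and the gains converge by dominated convergence.
  · let w : ℕ → unitInterval := fun n =>
      Set.projIcc (0 : ℝ) 1 zero_le_one ((v : ℝ) + 1 / ((n : ℝ) + 1))
    have hw0 : Filter.Tendsto (fun n : ℕ => (v : ℝ) + 1 / ((n : ℝ) + 1)) Filter.atTop
        (nhds (v : ℝ)) := by
      simpa using tendsto_one_div_add_atTop_nhds_zero_nat.const_add (v : ℝ)
    have hw : Filter.Tendsto w Filter.atTop (nhds v) := by
      have := (continuous_projIcc (h := zero_le_one (α := ℝ))).tendsto (v : ℝ)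
      have h2 := this.comp hw0
      rw [Set.projIcc_val] at h2
      exact h2
    have hvU : ∀ p, p ∈ U ↔ v < p := fun p =>
      ⟨fun hp => lt_of_le_of_ne ((hUv p).1 hp) (fun e => hv (e ▸ hp)), fun hp => by
        by_contra hpU
        exact absurd hp (not_lt.2 ((hUv p).2 hpU))⟩
    -- At `v = 1` there is no room to approximate from above, but then `U` is empty and the gain is
    -- zero.
    by_cases hv1 : (v : ℝ) = 1
    · have hz : ∀ p, setSign U p = -1 := by
        intro p
        have : p ∉ U := by
          rw [hvU]; intro hlt
          have h1 : (v : ℝ) < p := hlt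
          have := p.2.2
          linarith
        simp [setSign, this]
      have : gain J (fun p => setSign U (κ p)) U v = 0 := by
        simp [gain, hz]
      rw [this] at h
      linarith
    have hvlt : (v : ℝ) < 1 := lt_of_le_of_ne v.2.2 hv1
    have hwv : ∀ n, v < w n := by
      intro n
      show (v : ℝ) < w n
      have hn : (0 : ℝ) < 1 / ((n : ℝ) + 1) := by positivity
      have h0 := v.2.1
      simp only [w, Set.coe_projIcc]
      exact lt_max_of_lt_right (lt_min hvlt (by linarith))
    have hconv : ∀ p, Filter.Tendsto (fun n => setSign (Set.Ici (w n)) p) Filter.atTop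
        (nhds (setSign U p)) := by
      intro p
      by_cases hp : p ∈ U
      · have hlt := (hvU p).1 hp
        have hev : ∀ᶠ n in Filter.atTop, w n < p := hw.eventually_lt_const hlt
        refine (Filter.tendsto_congr' ?_).2 tendsto_const_nhds
        filter_upwards [hev] with n hn
        simp [setSign, hp, hn.le]
      · refine (Filter.tendsto_congr fun n => ?_).2 tendsto_const_nhds
        have : ¬ w n ≤ p := not_le.2 (lt_of_le_of_lt ((hUv p).2 hp) (hwv n))
        simp [setSign, hp, this]
    have hlim : Filter.Tendsto
        (fun n => gain J (fun p => setSign (Set.Ici (w n)) (κ p)) (Set.Ici (w n)) (w n))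
        Filter.atTop (nhds (gain J (fun p => setSign U (κ p)) U v)) := by
      unfold gain
      refine tendsto_integral_of_dominated_convergence (fun _ => 2) ?_ (integrable_const _) ?_ ?_
      · intro n
        exact (integrable_mul_outcome_sub J
          (measurable_sign_sub ((measurable_setSign measurableSet_Ici).comp hκ)
            measurableSet_Ici) (C := 2)
          (fun x => abs_sign_sub_le (f := setSign (Set.Ici (w n)) ∘ κ)
            (fun p => (abs_setSign _ _).le) _ _) _).aestronglyMeasurable
      · intro n
        refine Filter.Eventually.of_forall fun x => ?_
        rw [Real.norm_eq_abs, abs_mul]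
        calc _ ≤ (2 : ℝ) * 1 := mul_le_mul
              (abs_sign_sub_le (fun p => (abs_setSign _ (κ p)).le) _ _)
              (abs_outcome_sub_le _ _) (abs_nonneg _) (by norm_num)
          _ = 2 := mul_one _
      · refine Filter.Eventually.of_forall fun x => ?_
        refine ((hconv _).sub (hconv _)).mul (tendsto_const_nhds.sub ?_)
        exact (continuous_subtype_val.tendsto v).comp hw
    obtain ⟨n, hn⟩ := (hlim.eventually_const_lt h).exists
    exact ⟨w n, hn⟩

/-- Averaged over `y ∼ Be(p)` the difference is nonpositive by properness, and each of the two
losses varies by at most `1` with the outcome. This makes the supremum defining `CDL` finite. -/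
lemma loss_diff_le_two {l : unitInterval → Bool → ℝ} (hl : l ∈ properLosses)
    (p k : unitInterval) (y : Bool) : l p y - l k y ≤ 2 := by
  have h1 := hl.1 k p
  have hp := abs_le.1 (hl.2 p)
  have hk := abs_le.1 (hl.2 k)
  have p0 := p.2.1
  have p1 := p.2.2
  simp only [bernoulliMean] at h1
  cases y
  · nlinarith
  · nlinarith

lemma bddAbove_CDL (K : Set (unitInterval → unitInterval)) (J : Measure (unitInterval × Bool))
    [IsProbabilityMeasure J] :
    BddAbove {r | ∃ l ∈ properLosses, ∃ κ ∈ K, r = ∫ x, (l x.1 x.2 - l (κ x.1) x.2) ∂J} := by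
  refine ⟨2, ?_⟩
  rintro r ⟨l, hl, κ, -, rfl⟩
  by_cases hi : Integrable (fun x : unitInterval × Bool => l x.1 x.2 - l (κ x.1) x.2) J
  · have := integral_mono hi (integrable_const (2 : ℝ))
      (fun x => loss_diff_le_two hl x.1 (κ x.1) x.2)
    simpa using this
  · rw [integral_undef hi]; norm_num

/-- The threshold loss at `v`. -/
def thresholdLoss (v : unitInterval) (p : unitInterval) (y : Bool) : ℝ :=
  -(setSign (Set.Ici v) p * (outcome y - v))

lemma thresholdLoss_mem (v : unitInterval) : thresholdLoss v ∈ properLosses := by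
  refine ⟨fun p q => ?_, fun p => ?_⟩
  · have := (separates_Ici v).sign_mul_le p q
    simp only [bernoulliMean, thresholdLoss, outcome]
    simp only [if_true, Bool.false_eq_true, if_false]
    nlinarith
  · have : thresholdLoss v p true - thresholdLoss v p false = -setSign (Set.Ici v) p := by
      simp [thresholdLoss, outcome]; ring
    rw [this, abs_neg, abs_setSign]

lemma gain_le_CDL {K : Set (unitInterval → unitInterval)} (J : Measure (unitInterval × Bool))
    [IsProbabilityMeasure J] {κ : unitInterval → unitInterval} (hκ : κ ∈ K) (v : unitInterval) :
    gain J (fun p => setSign (Set.Ici v) (κ p)) (Set.Ici v) v ≤ CDL K J := by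
  refine le_csSup (bddAbove_CDL K J) ⟨thresholdLoss v, thresholdLoss_mem v, κ, hκ, ?_⟩
  unfold gain thresholdLoss
  congr 1
  funext x
  ring

lemma CDL_nonneg {K : Set (unitInterval → unitInterval)} (hK : IsValidClass K)
    (J : Measure (unitInterval × Bool)) [IsProbabilityMeasure J] : 0 ≤ CDL K J := by
  have := gain_le_CDL J hK.id_mem 0
  simpa [gain] using this

lemma exists_gain_gt_of_lt_CDL {K : Set (unitInterval → unitInterval)}
    (hK : IsValidClass K) (hm : ∀ κ ∈ K, Measurable κ)
    (J : Measure (unitInterval × Bool)) [IsProbabilityMeasure J] {c : ℝ} (hc : 0 ≤ c)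
    (h : c < CDL K J) :
    ∃ κ ∈ K, ∃ w, c < gain J (fun p => setSign (Set.Ici w) (κ p)) (Set.Ici w) w := by
  unfold CDL at h
  have hne : {r | ∃ l ∈ properLosses, ∃ κ ∈ K,
      r = ∫ x, (l x.1 x.2 - l (κ x.1) x.2) ∂J}.Nonempty :=
    ⟨_, thresholdLoss 0, thresholdLoss_mem 0, _, hK.id_mem, rfl⟩
  obtain ⟨r, ⟨l, hl, κ, hκ, rfl⟩, hr⟩ := exists_lt_of_lt_csSup hne h
  obtain ⟨U, v, hUv, hg⟩ := exists_gain_gt_of_integral_gt J hl (hm κ hκ) hc hr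
  exact ⟨κ, hκ, exists_closed_gain_gt J (hm κ hκ) hc hUv hg⟩

/-! ### Thresholds of a valid class, and upper bounds on the gain -/

lemma shift_mem {K : Set (unitInterval → unitInterval)} (hK : IsValidClass K)
    {κ : unitInterval → unitInterval} (hκ : κ ∈ K) (t : ℝ) :
    (fun p => Set.projIcc (0 : ℝ) 1 zero_le_one ((κ p : ℝ) + t)) ∈ K := by
  have := hK.translate_mem κ hκ 0 t
  simpa using this

/-- Thresholding `κ ∈ K` at any level gives a member of `thr K`. -/
lemma threshold_mem_thr {K : Set (unitInterval → unitInterval)} (hK : IsValidClass K)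
    {κ : unitInterval → unitInterval} (hκ : κ ∈ K) (w : unitInterval) :
    (fun p => decide (w ≤ κ p)) ∈ thr K := by
  refine ⟨_, shift_mem hK hκ (1 / 2 - w), ?_⟩
  funext p
  have e : (0 ≤ (Set.projIcc (0 : ℝ) 1 zero_le_one ((κ p : ℝ) + (1 / 2 - w)) : ℝ) - 1 / 2) ↔
      w ≤ κ p := by
    rw [Set.coe_projIcc]
    have : w ≤ κ p ↔ (w : ℝ) ≤ κ p := Iff.rfl
    rw [this, sub_nonneg, le_max_iff, le_min_iff]
    constructor
    · rintro (h | ⟨-, h⟩)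
      · norm_num at h
      · linarith
    · intro h
      exact Or.inr ⟨by norm_num, by linarith⟩
  simp only [signPlus, e]
  by_cases h : w ≤ κ p <;> simp [h]

lemma signVal_decide_le (w k : unitInterval) :
    signVal (decide (w ≤ k)) = setSign (Set.Ici w) k := by
  by_cases h : w ≤ k <;> simp [signVal, setSign, h]

/-- A member of `thr K` gains at most `CDL K J` over any closed threshold. -/
lemma gain_le_CDL_of_mem_thr {K : Set (unitInterval → unitInterval)} (hK : IsValidClass K)
    (J : Measure (unitInterval × Bool)) [IsProbabilityMeasure J] {h : unitInterval → Bool}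
    (hh : h ∈ thr K) (t : unitInterval) :
    gain J (fun p => signVal (h p)) (Set.Ici t) t ≤ CDL K J := by
  obtain ⟨κ, hκ, rfl⟩ := hh
  -- Moving the cut-off `1/2` to `t` fails at `t = 0`, where truncation makes every shifted value
  -- reach `t`. There the trivial threshold always decides `+1`, which is optimal for outcomes in
  -- `{0,1}`.
  by_cases ht : (t : ℝ) = 0
  · refine le_trans ?_ (CDL_nonneg hK J)
    refine integral_nonpos fun x => ?_
    have h1 : setSign (Set.Ici t) x.1 = 1 := by
      have : t ≤ x.1 := by
        show (t : ℝ) ≤ x.1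
        rw [ht]; exact x.1.2.1
      simp [setSign, this]
    have h2 : signVal (signPlus ((κ x.1 : ℝ) - 1 / 2)) ≤ 1 := by
      unfold signVal; split_ifs <;> norm_num
    simp only [h1, ht, sub_zero]
    exact mul_nonpos_of_nonpos_of_nonneg (by linarith) (outcome_nonneg _)
  · have ht0 : 0 < (t : ℝ) := lt_of_le_of_ne t.2.1 (Ne.symm ht)
    refine le_trans (le_of_eq ?_) (gain_le_CDL J (shift_mem hK hκ (t - 1 / 2)) t)
    congr 1
    funext p
    have e : (t ≤ Set.projIcc (0 : ℝ) 1 zero_le_one ((κ p : ℝ) + (t - 1 / 2))) ↔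
        0 ≤ (κ p : ℝ) - 1 / 2 := by
      have : (t ≤ Set.projIcc (0 : ℝ) 1 zero_le_one ((κ p : ℝ) + (t - 1 / 2))) ↔
        (t : ℝ) ≤ Set.projIcc (0 : ℝ) 1 zero_le_one ((κ p : ℝ) + (t - 1 / 2)) := Iff.rfl
      rw [this, Set.coe_projIcc, le_max_iff, le_min_iff]
      constructor
      · rintro (h | ⟨-, h⟩) <;> linarith
      · intro h
        exact Or.inr ⟨t.2.2, by linarith⟩
    by_cases h : 0 ≤ (κ p : ℝ) - 1 / 2
    · have h' := e.2 h
      simp only [setSign, Set.mem_Ici, h', signPlus, h, signVal, if_true]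
    · have h' := mt e.1 h
      simp only [setSign, Set.mem_Ici, h', signPlus, h, signVal, if_false, Bool.false_eq_true]

lemma ECE_nonneg (J : Measure (unitInterval × Bool)) : 0 ≤ ECE J :=
  integral_nonneg fun _ => abs_nonneg _

/-- The σ-algebra generated by the prediction. -/
abbrev firstSigma : MeasurableSpace (unitInterval × Bool) :=
  MeasurableSpace.comap Prod.fst inferInstance

/-- Any decisions gain at most twice the calibration error over any closed threshold. -/
lemma gain_le_ECE (J : Measure (unitInterval × Bool)) [IsProbabilityMeasure J]
    {f : unitInterval → ℝ} (hf : Measurable f) (hb : ∀ p, |f p| ≤ 1) (t : unitInterval) :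
    gain J f (Set.Ici t) t ≤ 2 * ECE J := by
  have hle : firstSigma ≤ Prod.instMeasurableSpace := measurable_fst.comap_le
  set W : unitInterval × Bool → ℝ := fun x => f x.1 - setSign (Set.Ici t) x.1 with hW
  set E : unitInterval × Bool → ℝ := fun x => outcome x.2 - (x.1 : ℝ) with hE
  have hWm : Measurable W := measurable_sign_sub hf measurableSet_Ici
  have hWb : ∀ x, |W x| ≤ 2 := fun x => abs_sign_sub_le hb _ _
  have hW0 : StronglyMeasurable[firstSigma] W := by
    have : Measurable[firstSigma] W :=
      (hf.sub (measurable_setSign measurableSet_Ici)).comp (comap_measurable Prod.fst)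
    exact this.stronglyMeasurable
  have hEm : Measurable E := (measurable_outcome.comp measurable_snd).sub
    (measurable_subtype_coe.comp measurable_fst)
  have hEi : Integrable E J := Integrable.of_bound hEm.aestronglyMeasurable 1
    (Filter.Eventually.of_forall fun x => abs_outcome_sub_le _ _)
  have hWE : Integrable (fun x => W x * E x) J := by
    refine Integrable.of_bound (hWm.mul hEm).aestronglyMeasurable 2
      (Filter.Eventually.of_forall fun x => ?_)
    rw [Real.norm_eq_abs, abs_mul]
    calc _ ≤ (2 : ℝ) * 1 := mul_le_mul (hWb x) (abs_outcome_sub_le _ _) (abs_nonneg _)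
            (by norm_num)
      _ = 2 := mul_one _
  -- `W` and `p - t` have opposite signs, so replacing `t` by `p` can only increase the integrand.
  have h1 : gain J f (Set.Ici t) t ≤ ∫ x, W x * E x ∂J := by
    refine integral_mono (integrable_mul_outcome_sub J hWm hWb t) hWE fun x => ?_
    have hs : W x * ((x.1 : ℝ) - t) ≤ 0 := by
      simp only [hW]
      by_cases hx : t ≤ x.1
      · have : (t : ℝ) ≤ x.1 := hx
        have h2 := (abs_le.1 (hb x.1)).2
        have h3 : setSign (Set.Ici t) x.1 = 1 := by simp [setSign, hx]
        rw [h3]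
        exact mul_nonpos_of_nonpos_of_nonneg (by linarith) (by linarith)
      · have : (x.1 : ℝ) < t := not_le.1 hx
        have h2 := (abs_le.1 (hb x.1)).1
        have h3 : setSign (Set.Ici t) x.1 = -1 := by simp [setSign, hx]
        rw [h3]
        exact mul_nonpos_of_nonneg_of_nonpos (by linarith) (by linarith)
    show W x * (outcome x.2 - t) ≤ W x * (outcome x.2 - x.1)
    linarith
  -- `W` depends on the prediction alone, so it pulls out of the conditional expectation.
  have h2 : ∫ x, W x * E x ∂J = ∫ x, W x * (condExp firstSigma J E) x ∂J := by
    rw [← integral_condExp hle (f := fun x => W x * E x)]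
    exact integral_congr_ae (condExp_mul_of_stronglyMeasurable_left hW0 hWE hEi)
  have h3 : ∫ x, W x * (condExp firstSigma J E) x ∂J ≤ ∫ x, 2 * |(condExp firstSigma J E) x| ∂J := by
    refine integral_mono ?_ (integrable_condExp.abs.const_mul 2) fun x => ?_
    · exact integrable_condExp.bdd_mul (c := 2) hWm.aestronglyMeasurable
        (Filter.Eventually.of_forall fun x => by rw [Real.norm_eq_abs]; exact hWb x)
    · refine (le_abs_self _).trans ?_
      rw [abs_mul]
      exact mul_le_mul_of_nonneg_right (hWb x) (abs_nonneg _)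
  rw [integral_const_mul] at h3
  have h4 : ECE J = ∫ x, |(condExp firstSigma J E) x| ∂J := rfl
  rw [h4]
  linarith

end

section

/-! ### Concentration and product measures -/

open ProbabilityTheory in
-- Variables with values in `[-1,1]` are sub-Gaussian with parameter `1` after centring. The
-- one-sided bound is applied to `f` and to `-f`.
lemma hoeffding_pi {Z ι : Type*} [MeasurableSpace Z] [Fintype ι] (J : Measure Z)
    [IsProbabilityMeasure J] {f : Z → ℝ} (hf : Measurable f) (hb : ∀ z, |f z| ≤ 1) {τ : ℝ}
    (hτ : 0 ≤ τ) :
    (Measure.pi fun _ : ι => J) {x | (Fintype.card ι : ℝ) * τ ≤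
      |∑ b, f (x b) - Fintype.card ι * ∫ z, f z ∂J|} ≤
      ENNReal.ofReal (2 * Real.exp (-(Fintype.card ι * τ ^ 2 / 2))) := by
  set n : ℝ := (Fintype.card ι : ℝ) with hn
  have hn0 : 0 ≤ n := Nat.cast_nonneg _
  have one : ∀ g : Z → ℝ, Measurable g → (∀ z, |g z| ≤ 1) →
      (Measure.pi fun _ : ι => J) {x | n * τ ≤ ∑ b, (g (x b) - ∫ z, g z ∂J)} ≤
      ENNReal.ofReal (Real.exp (-(n * τ ^ 2 / 2))) := by
    intro g hg hgb
    have hind : iIndepFun (fun (b : ι) (x : ι → Z) => g (x b) - ∫ z, g z ∂J)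
        (Measure.pi fun _ : ι => J) :=
      iIndepFun_pi (μ := fun _ : ι => J) (X := fun _ z => g z - ∫ z, g z ∂J)
        (fun _ => (hg.sub_const _).aemeasurable)
    have hsub : ∀ b ∈ (Finset.univ : Finset ι), HasSubgaussianMGF
        (fun x : ι → Z => g (x b) - ∫ z, g z ∂J) 1 (Measure.pi fun _ : ι => J) := by
      intro b _
      have h1 := hasSubgaussianMGF_of_mem_Icc (μ := Measure.pi fun _ : ι => J)
        (X := fun x : ι → Z => g (x b)) (a := -1) (b := 1)
        (hg.comp (measurable_pi_apply b)).aemeasurable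
        (Filter.Eventually.of_forall fun x => abs_le.1 (hgb _))
      have h2 : ∫ x : ι → Z, g (x b) ∂(Measure.pi fun _ : ι => J) = ∫ z, g z ∂J := by
        rw [← (measurePreserving_eval (fun _ : ι => J) b).map_eq,
          integral_map (measurable_pi_apply b).aemeasurable]
        rw [(measurePreserving_eval (fun _ : ι => J) b).map_eq]
        exact hg.aestronglyMeasurable
      rw [h2] at h1
      convert h1 using 1
      norm_num
    have h3 := HasSubgaussianMGF.measure_sum_ge_le_of_iIndepFun hind hsub (ε := n * τ)
      (by positivity)
    rw [← ENNReal.ofReal_toReal (measure_ne_top (Measure.pi fun _ : ι => J) _)]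
    refine ENNReal.ofReal_le_ofReal (h3.trans (le_of_eq ?_))
    congr 1
    simp only [Finset.sum_const, Finset.card_univ, nsmul_eq_mul, mul_one, NNReal.coe_natCast]
    rw [← hn]
    rcases hn0.eq_or_lt with h | h
    · rw [← h]; simp
    · field_simp
  have hsum : ∀ x : ι → Z, ∑ b, (f (x b) - ∫ z, f z ∂J) = ∑ b, f (x b) - n * ∫ z, f z ∂J := by
    intro x
    rw [Finset.sum_sub_distrib]; simp [hn]
  have hsub : {x : ι → Z | n * τ ≤ |∑ b, f (x b) - n * ∫ z, f z ∂J|} ⊆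
      {x | n * τ ≤ ∑ b, (f (x b) - ∫ z, f z ∂J)} ∪
      {x | n * τ ≤ ∑ b, ((fun z => -f z) (x b) - ∫ z, (fun z => -f z) z ∂J)} := by
    intro x hx
    have hx' : n * τ ≤ |∑ b, f (x b) - n * ∫ z, f z ∂J| := hx
    rcases le_abs.1 hx' with h | h
    · left
      show n * τ ≤ _
      rw [hsum]; exact h
    · right
      show n * τ ≤ _
      have : ∑ b, ((fun z => -f z) (x b) - ∫ z, (fun z => -f z) z ∂J) =
          -∑ b, (f (x b) - ∫ z, f z ∂J) := by
        rw [← Finset.sum_neg_distrib, integral_neg]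
        exact Finset.sum_congr rfl fun b _ => by ring
      rw [this, hsum]; exact h
  refine (measure_mono hsub).trans ((measure_union_le _ _).trans ?_)
  rw [two_mul, ENNReal.ofReal_add (Real.exp_nonneg _) (Real.exp_nonneg _)]
  exact add_le_add (one f hf hb) (one (fun z => -f z) hf.neg fun z => by rw [abs_neg]; exact hb z)

/-- Hoeffding's inequality for a function that depends on an independent parameter. -/
lemma hoeffding_prod {Z ι Θ : Type*} [MeasurableSpace Z] [MeasurableSpace Θ] [Fintype ι]
    (J : Measure Z) [IsProbabilityMeasure J] (π : Measure Θ) [IsProbabilityMeasure π]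
    {f : Θ → Z → ℝ} (hf : Measurable (Function.uncurry f)) (hb : ∀ θ z, |f θ z| ≤ 1) {τ : ℝ}
    (hτ : 0 ≤ τ) :
    (π.prod (Measure.pi fun _ : ι => J)) {x | (Fintype.card ι : ℝ) * τ ≤
      |∑ b, f x.1 (x.2 b) - Fintype.card ι * ∫ z, f x.1 z ∂J|} ≤
      ENNReal.ofReal (2 * Real.exp (-(Fintype.card ι * τ ^ 2 / 2))) := by
  have hint : Measurable (fun θ => ∫ z, f θ z ∂J) :=
    (hf.stronglyMeasurable.integral_prod_right (ν := J)).measurable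
  have hms : MeasurableSet {x : Θ × (ι → Z) | (Fintype.card ι : ℝ) * τ ≤
      |∑ b, f x.1 (x.2 b) - Fintype.card ι * ∫ z, f x.1 z ∂J|} := by
    refine measurableSet_le measurable_const ?_
    refine Measurable.abs (Measurable.sub (Finset.measurable_sum _ fun b _ => ?_)
      ((hint.comp measurable_fst).const_mul _))
    exact hf.comp (measurable_fst.prodMk ((measurable_pi_apply b).comp measurable_snd))
  rw [Measure.prod_apply hms]
  calc _ ≤ ∫⁻ _, ENNReal.ofReal (2 * Real.exp (-(Fintype.card ι * τ ^ 2 / 2))) ∂π :=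
        lintegral_mono fun θ =>
          hoeffding_pi J (hf.comp measurable_prodMk_left) (hb θ) hτ
    _ = _ := by simp

open Classical in
/-- In `2 k` independent trials a bad event of probability at most `c / 4` occurs at least `k` times
with probability at most `c ^ k`. -/
lemma majority_bound {B : Type*} [MeasurableSpace B] (ν : Measure B) [IsProbabilityMeasure ν]
    {bad : Set B} {c : ENNReal} (hbad : 4 * ν bad ≤ c) (k : ℕ) :
    (Measure.pi fun _ : Fin (2 * k) => ν)
      {b | k ≤ (Finset.univ.filter fun r => b r ∈ bad).card} ≤ c ^ k := by
  -- Union bound over which `k` trials are bad; there are `(2k).choose k ≤ 4^k` choices, which is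
  -- the source of the factor `4`.
  have hsub : {b : Fin (2 * k) → B | k ≤ (Finset.univ.filter fun r => b r ∈ bad).card} ⊆
      ⋃ S ∈ Finset.powersetCard k (Finset.univ : Finset (Fin (2 * k))),
        Set.univ.pi fun r => if r ∈ S then bad else Set.univ := by
    intro b hb
    obtain ⟨S, hS, hc⟩ := Finset.exists_subset_card_eq hb
    simp only [Set.mem_iUnion]
    refine ⟨S, Finset.mem_powersetCard.2 ⟨Finset.subset_univ _, hc⟩, fun r _ => ?_⟩
    by_cases hr : r ∈ S
    · have := (Finset.mem_filter.1 (hS hr)).2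
      simpa [hr] using this
    · simp [hr]
  refine (measure_mono hsub).trans ((measure_biUnion_finset_le _ _).trans ?_)
  have h1 : ∀ S ∈ Finset.powersetCard k (Finset.univ : Finset (Fin (2 * k))),
      (Measure.pi fun _ : Fin (2 * k) => ν)
        (Set.univ.pi fun r => if r ∈ S then bad else Set.univ) = ν bad ^ k := by
    intro S hS
    rw [Measure.pi_pi]
    have : ∀ r, ν (if r ∈ S then bad else Set.univ) = if r ∈ S then ν bad else 1 := by
      intro r; split_ifs <;> simp
    simp_rw [this]
    rw [Finset.prod_ite_mem, Finset.univ_inter, Finset.prod_const,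
      (Finset.mem_powersetCard.1 hS).2]
  rw [Finset.sum_congr rfl h1, Finset.sum_const, Finset.card_powersetCard, Finset.card_univ,
    Fintype.card_fin, nsmul_eq_mul]
  calc ((2 * k).choose k : ENNReal) * ν bad ^ k ≤ (4 : ENNReal) ^ k * ν bad ^ k := by
        gcongr
        have := Nat.choose_le_two_pow (2 * k) k
        rw [pow_mul] at this
        exact_mod_cast this
    _ = (4 * ν bad) ^ k := (mul_pow _ _ _).symm
    _ ≤ c ^ k := pow_le_pow_left' hbad k

/-- This direction holds for outer measures of arbitrary sets, so failure events never have to be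
shown measurable when they are transported. -/
lemma measure_preimage_le_of_preserving {A B : Type*} [MeasurableSpace A] [MeasurableSpace B]
    {μ : Measure A} {ν : Measure B} {f : A → B} (hf : MeasurePreserving f μ ν) (s : Set B) :
    μ (f ⁻¹' s) ≤ ν s := by
  rw [← hf.map_eq]
  exact Measure.le_map_apply hf.measurable.aemeasurable s

lemma measurePreserving_regroup {ι κ ρ X : Type*} [Fintype ι] [Fintype κ] [Fintype ρ]
    [MeasurableSpace X] (μ : Measure X) [IsProbabilityMeasure μ] (e : ι ≃ κ × ρ) :
    MeasurePreserving (fun (x : ι → X) (k : κ) (r : ρ) => x (e.symm (k, r)))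
      (Measure.pi fun _ => μ) (Measure.pi fun _ => Measure.pi fun _ => μ) := by
  have h1 := measurePreserving_piCongrLeft (α := fun _ : κ × ρ => X) (fun _ => μ) e
  have h2 : MeasurePreserving (MeasurableEquiv.curry κ ρ X)
      (Measure.pi fun _ : κ × ρ => μ) (Measure.pi fun _ => Measure.pi fun _ => μ) := by
    refine ⟨(MeasurableEquiv.curry κ ρ X).measurable, ?_⟩
    have := Measure.infinitePi_map_curry (ι := κ) (κ := ρ) (X := X) (μ := fun _ _ => μ)
    simpa [Measure.infinitePi_eq_pi] using this
  have h3 := h2.comp h1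
  convert h3 using 1
  funext x k r
  show x (e.symm (k, r)) = (Equiv.piCongrLeft (fun _ => X) e) x (k, r)
  simp [Equiv.piCongrLeft_apply]

/-- The independent samples of a run fall into independent batches. -/
lemma measurePreserving_batches {ι κ ρ₁ ρ₂ σ χ X Y : Type*} [Fintype ι] [Fintype κ] [Fintype ρ₁]
    [Fintype ρ₂] [Fintype σ] [Fintype χ] [MeasurableSpace X] [MeasurableSpace Y] (μ : Measure X)
    [IsProbabilityMeasure μ] (ν : Measure Y) [IsProbabilityMeasure ν] (e₁ : ι ≃ κ × (ρ₁ ⊕ ρ₂))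
    (e₂ : χ ≃ κ × σ) :
    MeasurePreserving (fun (s : (ι → X) × (χ → Y)) (k : κ) =>
        (((fun a : ρ₁ => s.1 (e₁.symm (k, Sum.inl a))), fun c : σ => s.2 (e₂.symm (k, c))),
          (fun b : ρ₂ => s.1 (e₁.symm (k, Sum.inr b)))))
      ((Measure.pi fun _ => μ).prod (Measure.pi fun _ => ν))
      (Measure.pi fun _ => (((Measure.pi fun _ => μ).prod (Measure.pi fun _ => ν)).prod
        (Measure.pi fun _ => μ))) := by
  have h1 : MeasurePreserving (fun (s : (ι → X) × (χ → Y)) =>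
      ((fun (k : κ) (r : ρ₁ ⊕ ρ₂) => s.1 (e₁.symm (k, r))),
        (fun (k : κ) (c : σ) => s.2 (e₂.symm (k, c)))))
      ((Measure.pi fun _ => μ).prod (Measure.pi fun _ => ν))
      ((Measure.pi fun _ => Measure.pi fun _ => μ).prod
        (Measure.pi fun _ => Measure.pi fun _ => ν)) :=
    (measurePreserving_regroup μ e₁).prod (measurePreserving_regroup ν e₂)
  have h2 := (measurePreserving_arrowProdEquivProdArrow (ρ₁ ⊕ ρ₂ → X) (σ → Y) κ
    (fun _ => Measure.pi fun _ => μ) (fun _ => Measure.pi fun _ => ν)).symm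
  have h3 : MeasurePreserving (fun w : (ρ₁ ⊕ ρ₂ → X) × (σ → Y) =>
      (((fun a => w.1 (Sum.inl a)), w.2), (fun b => w.1 (Sum.inr b))))
      ((Measure.pi fun _ => μ).prod (Measure.pi fun _ => ν))
      (((Measure.pi fun _ => μ).prod (Measure.pi fun _ => ν)).prod (Measure.pi fun _ => μ)) := by
    have a := (measurePreserving_sumPiEquivProdPi (X := fun _ : ρ₁ ⊕ ρ₂ => X)
      (fun _ => μ)).prod (MeasurePreserving.id (Measure.pi fun _ : σ => ν))
    have b : MeasurePreserving (fun w : ((ρ₁ → X) × (ρ₂ → X)) × (σ → Y) => ((w.1.1, w.2), w.1.2))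
        (((Measure.pi fun _ => μ).prod (Measure.pi fun _ => μ)).prod (Measure.pi fun _ => ν))
        (((Measure.pi fun _ => μ).prod (Measure.pi fun _ => ν)).prod (Measure.pi fun _ => μ)) := by
      have p1 := measurePreserving_prodAssoc (Measure.pi fun _ : ρ₁ => μ)
        (Measure.pi fun _ : ρ₂ => μ) (Measure.pi fun _ : σ => ν)
      have p2 := (MeasurePreserving.id (Measure.pi fun _ : ρ₁ => μ)).prod
        (Measure.measurePreserving_swap (μ := Measure.pi fun _ : ρ₂ => μ)
          (ν := Measure.pi fun _ : σ => ν))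
      have p3 := (measurePreserving_prodAssoc (Measure.pi fun _ : ρ₁ => μ)
        (Measure.pi fun _ : σ => ν) (Measure.pi fun _ : ρ₂ => μ)).symm
      exact p3.comp (p2.comp p1)
    exact b.comp a
  exact (measurePreserving_pi _ _ fun _ => h3).comp (h2.comp h1)

/-! ### Quantiles -/

/-- Take the least `b` at which the closed interval from `w` reaches mass `c`: continuity from below
bounds the half-open interval, continuity from above the closed one. Stating both handles atoms. A
sample that hits `[w,b]` is a cut-off separated from `w` by mass at most `c`. -/
lemma exists_quantile (μ : Measure unitInterval) [IsFiniteMeasure μ] (c : ENNReal)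
    {w V : unitInterval} (hwV : w ≤ V) :
    μ (Set.Ico w V) ≤ c ∨
      ∃ b ∈ Set.Icc w V, μ (Set.Ico w b) ≤ c ∧ c ≤ μ (Set.Icc w b) := by
  by_cases hV : c ≤ μ (Set.Icc w V)
  swap
  · exact Or.inl ((measure_mono Set.Ico_subset_Icc_self).trans (not_le.1 hV).le)
  right
  set A : Set unitInterval := {b | w ≤ b ∧ c ≤ μ (Set.Icc w b)} with hA
  have hne : A.Nonempty := ⟨V, hwV, hV⟩
  have hlow : ∀ b, b < sInf A → μ (Set.Icc w b) ≤ c := by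
    intro b hb
    by_cases hwb : w ≤ b
    · by_contra hc
      exact absurd (sInf_le (show b ∈ A from ⟨hwb, (not_le.1 hc).le⟩)) (not_le.2 hb)
    · rw [Set.Icc_eq_empty hwb]; simp
  refine ⟨sInf A, ⟨le_sInf fun b hb => hb.1, sInf_le ⟨hwV, hV⟩⟩, ?_, ?_⟩
  · rcases (le_sInf fun b hb => hb.1 : w ≤ sInf A).eq_or_lt with h | h
    · rw [← h]; simp
    · obtain ⟨u, hu, hlt, ht⟩ := exists_seq_strictMono_tendsto' h
      have : Set.Ico w (sInf A) ⊆ ⋃ n, Set.Icc w (u n) := by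
        intro p hp
        obtain ⟨n, hn⟩ := (ht.eventually_const_lt hp.2).exists
        exact Set.mem_iUnion.2 ⟨n, hp.1, hn.le⟩
      refine (measure_mono this).trans ?_
      rw [Monotone.measure_iUnion]
      · exact iSup_le fun n => hlow _ (hlt n).2
      · intro m n hmn
        exact Set.Icc_subset_Icc_right (hu.monotone hmn)
  · obtain ⟨u, hu, ht, hm⟩ := exists_seq_tendsto_sInf hne (OrderBot.bddBelow A)
    have : Set.Icc w (sInf A) = ⋂ n, Set.Icc w (u n) := by
      ext p
      simp only [Set.mem_Icc, Set.mem_iInter]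
      refine ⟨fun hp n => ⟨hp.1, hp.2.trans (sInf_le (hm n))⟩, fun hp => ⟨(hp 0).1, ?_⟩⟩
      exact ge_of_tendsto' ht fun n => (hp n).2
    rw [this, Antitone.measure_iInter]
    · exact le_iInf fun n => (hm n).2
    · intro m n hmn
      exact Set.Icc_subset_Icc_right (hu hmn)
    · exact fun n => measurableSet_Icc.nullMeasurableSet
    · exact ⟨0, measure_ne_top _ _⟩

lemma miss_bound {Z ι : Type*} [MeasurableSpace Z] [Fintype ι] (J : Measure Z)
    [IsProbabilityMeasure J] {S : Set Z} (hS : MeasurableSet S) {c : ℝ}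
    (hc0 : 0 ≤ c) (hc : ENNReal.ofReal c ≤ J S) :
    (Measure.pi fun _ : ι => J) {x | ∀ a, x a ∉ S} ≤
      ENNReal.ofReal (Real.exp (-(c * Fintype.card ι))) := by
  have : {x : ι → Z | ∀ a, x a ∉ S} = Set.univ.pi fun _ => Sᶜ := by
    ext x; simp
  rw [this, Measure.pi_pi, Finset.prod_const, Finset.card_univ, prob_compl_eq_one_sub hS]
  have h1 : 1 - J S ≤ ENNReal.ofReal (Real.exp (-c)) := by
    calc 1 - J S ≤ 1 - ENNReal.ofReal c := tsub_le_tsub_left hc _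
      _ = ENNReal.ofReal (1 - c) := by rw [ENNReal.ofReal_sub _ hc0, ENNReal.ofReal_one]
      _ ≤ _ := ENNReal.ofReal_le_ofReal (by have := Real.add_one_le_exp (-c); linarith)
  calc (1 - J S) ^ Fintype.card ι ≤ (ENNReal.ofReal (Real.exp (-c))) ^ Fintype.card ι :=
        pow_le_pow_left' h1 _
    _ = _ := by
      rw [← ENNReal.ofReal_pow (Real.exp_nonneg _), ← Real.exp_nat_mul]
      congr 2; ring

/-! ### Learning from randomized labels -/

lemma measurable_signVal : Measurable signVal := measurable_of_finite _

lemma abs_signVal (z : Bool) : |signVal z| = 1 := by cases z <;> simp [signVal]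

/-- The probability of the label `+1` that gives the label the mean `y - v`. -/
def labelProb (v : ℝ) (y : Bool) : ℝ := (1 + (outcome y - v)) / 2

/-- Draws the label of an example with a uniform random number. -/
def relabel (v : ℝ) (z : (unitInterval × Bool) × unitInterval) : unitInterval × Bool :=
  (z.1.1, if (z.2 : ℝ) < labelProb v z.1.2 then true else false)

lemma measurable_relabel (v : ℝ) : Measurable (relabel v) := by
  refine (measurable_fst.comp measurable_fst).prodMk (Measurable.ite ?_ measurable_const
    measurable_const)
  refine measurableSet_lt (measurable_subtype_coe.comp measurable_snd) ?_
  exact (measurable_of_finite (labelProb v)).comp (measurable_snd.comp measurable_fst)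

/-- The distribution of the relabelled examples. -/
def relabelled (v : ℝ) (J : Measure (unitInterval × Bool)) : Measure (unitInterval × Bool) :=
  (J.prod (volume : Measure unitInterval)).map (relabel v)

instance (v : ℝ) (J : Measure (unitInterval × Bool)) [IsProbabilityMeasure J] :
    IsProbabilityMeasure (relabelled v J) :=
  Measure.isProbabilityMeasure_map (measurable_relabel v).aemeasurable

/-- The correlation of decisions with `y - v`. -/
def corr (J : Measure (unitInterval × Bool)) (v : ℝ) (f : unitInterval → ℝ) : ℝ :=
  ∫ x, f x.1 * (outcome x.2 - v) ∂J

lemma integrable_corr (J : Measure (unitInterval × Bool)) [IsFiniteMeasure J]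
    (v : unitInterval) {f : unitInterval → ℝ} (hf : Measurable f) (hb : ∀ p, |f p| ≤ 1) :
    Integrable (fun x : unitInterval × Bool => f x.1 * (outcome x.2 - v)) J :=
  integrable_mul_outcome_sub J (f := fun x => f x.1) (hf.comp measurable_fst) (fun _ => hb _) v

/-- Given `(p,y)`, the sign has mean `y - v`, so it disagrees with `f p` with probability `(1 -
f(p)(y-v))/2`. An error `ε` thus becomes `2ε` in correlation. -/
lemma err_relabelled (J : Measure (unitInterval × Bool)) [IsProbabilityMeasure J]
    (v : unitInterval) {f : unitInterval → Bool} (hf : Measurable f) :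
    err (relabelled v J) f = 1 / 2 - 1 / 2 * corr J v (fun p => signVal (f p)) := by
  have hE : MeasurableSet {x : unitInterval × Bool | f x.1 ≠ x.2} :=
    (measurableSet_eq_fun (hf.comp measurable_fst) measurable_snd).compl
  have hE' := measurable_relabel v hE
  have hsec : ∀ x : unitInterval × Bool,
      (volume : Measure unitInterval).real
        {u | f (relabel v (x, u)).1 ≠ (relabel v (x, u)).2} =
      1 / 2 - 1 / 2 * (signVal (f x.1) * (outcome x.2 - v)) := by
    intro x
    have hb := abs_le.1 (abs_outcome_sub_le x.2 v)
    have h0 : 0 ≤ labelProb v x.2 := by unfold labelProb; linarith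
    have h1 : labelProb v x.2 ≤ 1 := by unfold labelProb; linarith
    let q : unitInterval := ⟨labelProb v x.2, h0, h1⟩
    cases hfx : f x.1
    · have : {u : unitInterval | f (relabel v (x, u)).1 ≠ (relabel v (x, u)).2} = Set.Iio q := by
        ext u
        have e : u < q ↔ (u : ℝ) < labelProb v x.2 := Iff.rfl
        by_cases h : (u : ℝ) < labelProb v x.2 <;> simp [relabel, hfx, h, e]
      rw [this, Measure.real, unitInterval.volume_Iio, ENNReal.toReal_ofReal h0]
      simp only [labelProb, signVal]
      norm_num; ring
    · have : {u : unitInterval | f (relabel v (x, u)).1 ≠ (relabel v (x, u)).2} = Set.Ici q := by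
        ext u
        have e : q ≤ u ↔ labelProb v x.2 ≤ (u : ℝ) := Iff.rfl
        simp [relabel, hfx, e]
      rw [this, Measure.real, unitInterval.volume_Ici, ENNReal.toReal_ofReal (by
        show 0 ≤ 1 - labelProb v x.2
        linarith)]
      simp only [q, labelProb, signVal]
      norm_num; ring
  have h1 : err (relabelled v J) f = ∫ x, (volume : Measure unitInterval).real
        {u | f (relabel v (x, u)).1 ≠ (relabel v (x, u)).2} ∂J := by
    unfold err relabelled
    rw [map_measureReal_apply (measurable_relabel v) hE, measureReal_def, Measure.prod_apply hE',
      ← integral_toReal]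
    · rfl
    · exact (measurable_measure_prodMk_left hE').aemeasurable
    · exact Filter.Eventually.of_forall fun x => measure_lt_top _ _
  rw [h1]
  simp_rw [hsec]
  have hi := integrable_corr J v (f := fun p => signVal (f p)) (measurable_signVal.comp hf) (fun p => (abs_signVal _).le)
  rw [integral_sub (integrable_const _) (hi.const_mul _), integral_const_mul]
  simp [corr]

variable {m : ℕ}

/-- The law of what a call consumes: labelled examples, uniform random numbers and the seed. -/
def callLaw (AL : Learner.{u} m) (J : Measure (unitInterval × Bool)) :
    Measure ((Fin m → (unitInterval × Bool) × unitInterval) × AL.Ω) :=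
  (Measure.pi fun _ : Fin m => J.prod (volume : Measure unitInterval)).prod AL.P

instance (AL : Learner.{u} m) (J : Measure (unitInterval × Bool)) [IsProbabilityMeasure J] :
    IsProbabilityMeasure (callLaw AL J) := by
  unfold callLaw; infer_instance

/-- The hypothesis returned by a call with labels of mean `y - v`. -/
def callHyp (AL : Learner.{u} m) (v : ℝ)
    (c : (Fin m → (unitInterval × Bool) × unitInterval) × AL.Ω) : unitInterval → Bool :=
  AL.run (fun i => relabel v (c.1 i)) c.2

lemma measurable_callHyp (AL : Learner.{u} m) (v : ℝ) :
    Measurable (Function.uncurry (callHyp AL v)) := by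
  refine AL.measurable_run.comp
    (f := fun x : ((Fin m → (unitInterval × Bool) × unitInterval) × AL.Ω) × unitInterval =>
      (((fun i => relabel v (x.1.1 i)), x.1.2), x.2)) ?_
  refine Measurable.prodMk (Measurable.prodMk ?_ (measurable_snd.comp measurable_fst))
    measurable_snd
  exact measurable_pi_lambda _ fun i => (measurable_relabel v).comp
    ((measurable_pi_apply i).comp (measurable_fst.comp measurable_fst))

lemma measurable_callHyp_apply (AL : Learner.{u} m) (v : ℝ)
    (c : (Fin m → (unitInterval × Bool) × unitInterval) × AL.Ω) :
    Measurable (callHyp AL v c) :=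
  (measurable_callHyp AL v).comp measurable_prodMk_left

lemma measurable_err_run (AL : Learner.{u} m) (D : Measure (unitInterval × Bool))
    [IsProbabilityMeasure D] :
    Measurable (fun x : (Fin m → unitInterval × Bool) × AL.Ω => err D (AL.run x.1 x.2)) := by
  have hms : MeasurableSet {z : ((Fin m → unitInterval × Bool) × AL.Ω) × (unitInterval × Bool) |
      AL.run z.1.1 z.1.2 z.2.1 ≠ z.2.2} := by
    refine (measurableSet_eq_fun ?_ (measurable_snd.comp measurable_snd)).compl
    exact AL.measurable_run.comp (measurable_fst.prodMk (measurable_fst.comp measurable_snd))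
  exact (measurable_measure_prodMk_left hms).ennreal_toReal

/-- With probability at least `9/10` a call returns a hypothesis that is nearly as correlated with
`y - v` as any fixed member of the class. -/
lemma callLaw_bad_le (AL : Learner.{u} m) {ε : ℝ} {F : Set (unitInterval → Bool)}
    (hAL : AL.IsAgnostic ε F) (J : Measure (unitInterval × Bool)) [IsProbabilityMeasure J]
    (v : unitInterval) {f : unitInterval → Bool} (hf : Measurable f) (hfF : f ∈ F) :
    callLaw AL J {c | corr J v (fun p => signVal (callHyp AL v c p)) <
      corr J v (fun p => signVal (f p)) - 2 * ε} ≤ ENNReal.ofReal (1 / 10) := by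
  set D := relabelled v J with hD
  have hmp : MeasurePreserving (fun c : (Fin m → (unitInterval × Bool) × unitInterval) × AL.Ω =>
      ((fun i => relabel v (c.1 i)), c.2)) (callLaw AL J)
      ((Measure.pi fun _ : Fin m => D).prod AL.P) :=
    (measurePreserving_pi (fun _ : Fin m => J.prod (volume : Measure unitInterval)) (fun _ => D)
      fun _ => ⟨measurable_relabel v, rfl⟩).prod (MeasurePreserving.id AL.P)
  set good : Set ((Fin m → unitInterval × Bool) × AL.Ω) :=
    {x | err D (AL.run x.1 x.2) ≤ err D f + ε} with hgood
  have hgm : MeasurableSet good := measurableSet_le (measurable_err_run AL D) measurable_const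
  -- The learner's guarantee quantifies over the whole class and need not be a measurable event;
  -- comparison with the single `f` is measurable, so its complement has mass at most `1/10`.
  have hg : 9 / 10 ≤ ((Measure.pi fun _ : Fin m => D).prod AL.P).real good :=
    (hAL D inferInstance).trans (measureReal_mono fun x hx => hx f hfF)
  have hcomp : ((Measure.pi fun _ : Fin m => D).prod AL.P) goodᶜ ≤ ENNReal.ofReal (1 / 10) := by
    rw [← ofReal_measureReal]
    refine ENNReal.ofReal_le_ofReal ?_
    rw [probReal_compl_eq_one_sub hgm]
    linarith
  refine le_trans ?_ hcomp
  rw [← hmp.measure_preimage hgm.compl.nullMeasurableSet]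
  refine measure_mono fun c hc => ?_
  have hc' : corr J v (fun p => signVal (callHyp AL v c p)) <
      corr J v (fun p => signVal (f p)) - 2 * ε := hc
  show ¬ (err D (callHyp AL v c) ≤ err D f + ε)
  rw [hD, err_relabelled J v hf, err_relabelled J v (measurable_callHyp_apply AL v c)]
  linarith

end

section

/-! ### One batch of the audit -/

/-- The `i`-th point of the grid `1/N, 2/N, …, 1`. -/
def grid (N : ℕ) (i : Fin N) : unitInterval :=
  ⟨((i : ℝ) + 1) / N, by positivity, by
    have : 0 < N := i.pos
    have h : ((i : ℕ) : ℝ) + 1 ≤ N := by exact_mod_cast i.isLt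
    exact div_le_one_of_le₀ h (Nat.cast_nonneg _)⟩

lemma coe_grid (N : ℕ) (i : Fin N) : (grid N i : ℝ) = ((i : ℝ) + 1) / N := rfl

lemma exists_grid {N : ℕ} (hN : 0 < N) (w : unitInterval) :
    ∃ i, w ≤ grid N i ∧ (grid N i : ℝ) - 1 / N ≤ w := by
  have hN' : (0 : ℝ) < N := by exact_mod_cast hN
  have hw0 := w.2.1
  have hw1 := w.2.2
  have hc : ⌈(w : ℝ) * N⌉₊ ≤ N := Nat.ceil_le.2 (by nlinarith)
  have h1 := Nat.le_ceil ((w : ℝ) * N)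
  have h2 := Nat.ceil_lt_add_one (mul_nonneg hw0 hN'.le)
  -- For `w = 0` the truncated subtraction gives index `0`, the grid point `1/N`, which still
  -- satisfies both bounds.
  have hlt : ⌈(w : ℝ) * N⌉₊ - 1 < N := by omega
  refine ⟨⟨⌈(w : ℝ) * N⌉₊ - 1, hlt⟩, ?_, ?_⟩
  · show (w : ℝ) ≤ ((⌈(w : ℝ) * N⌉₊ - 1 : ℕ) + 1 : ℝ) / N
    rw [le_div_iff₀ hN']
    refine h1.trans ?_
    have : ⌈(w : ℝ) * N⌉₊ ≤ (⌈(w : ℝ) * N⌉₊ - 1) + 1 := by omega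
    exact_mod_cast this
  · rw [coe_grid, ← sub_div, div_le_iff₀ hN']
    simp only
    rcases Nat.eq_zero_or_pos ⌈(w : ℝ) * N⌉₊ with h | h
    · rw [h]; simp; positivity
    · rw [Nat.cast_sub h]; push_cast; linarith

lemma corr_sub_corr (J : Measure (unitInterval × Bool)) [IsProbabilityMeasure J]
    {f : unitInterval → ℝ} (hf : Measurable f) (hb : ∀ p, |f p| ≤ 1) (w : unitInterval) :
    corr J w f - corr J w (setSign (Set.Ici w)) = gain J f (Set.Ici w) w := by
  unfold corr gain
  rw [← integral_sub (integrable_corr J w hf hb) (integrable_corr J w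
    (measurable_setSign measurableSet_Ici) fun p => (abs_setSign _ p).le)]
  congr 1
  funext x
  ring

lemma corr_le_corr_add (J : Measure (unitInterval × Bool)) [IsProbabilityMeasure J]
    {f : unitInterval → ℝ} (hf : Measurable f) (hb : ∀ p, |f p| ≤ 1) (v w : unitInterval) :
    corr J w f ≤ corr J v f + |(v : ℝ) - w| := by
  have h := integral_mono (integrable_corr J w hf hb)
    ((integrable_corr J v hf hb).add (integrable_const |(v : ℝ) - w|)) (fun x => by
      show f x.1 * (outcome x.2 - w) ≤ f x.1 * (outcome x.2 - v) + |(v : ℝ) - w|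
      have h1 : f x.1 * ((v : ℝ) - w) ≤ |(v : ℝ) - w| := by
        refine (le_abs_self _).trans ?_
        rw [abs_mul]
        exact mul_le_of_le_one_left (abs_nonneg _) (hb _)
      linarith)
  have e : ∫ x : unitInterval × Bool,
      (fun x => f x.1 * (outcome x.2 - v)) x + (fun _ => |(v : ℝ) - w|) x ∂J =
      corr J v f + |(v : ℝ) - w| := by
    rw [integral_add (integrable_corr J v hf hb) (integrable_const _)]
    simp [corr]
  exact h.trans e.le

/-- Raising the cut-off flips the decision only on `[w,t)`, at a cost of at most `2` per unit of
mass there; moving the reference value costs `t - w`. -/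
lemma corr_threshold_le (J : Measure (unitInterval × Bool)) [IsProbabilityMeasure J]
    {w t : unitInterval} (hwt : w ≤ t) :
    corr J t (setSign (Set.Ici t)) ≤ corr J w (setSign (Set.Ici w)) +
      2 * (J.map Prod.fst).real (Set.Ico w t) + ((t : ℝ) - w) := by
  have hwt' : (w : ℝ) ≤ t := hwt
  have hS : ∀ u : unitInterval, Integrable (fun x : unitInterval × Bool =>
      setSign (Set.Ici u) x.1 * (outcome x.2 - u)) J := fun u =>
    integrable_corr J u (measurable_setSign measurableSet_Ici) fun p => (abs_setSign _ p).le
  have hms : MeasurableSet {x : unitInterval × Bool | x.1 ∈ Set.Ico w t} :=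
    measurable_fst measurableSet_Ico
  have hI : Integrable ({x : unitInterval × Bool | x.1 ∈ Set.Ico w t}.indicator
      (fun _ => (2 : ℝ))) J := (integrable_const _).indicator hms
  have hpt : ∀ x : unitInterval × Bool, setSign (Set.Ici t) x.1 * (outcome x.2 - t) ≤
      (setSign (Set.Ici w) x.1 * (outcome x.2 - w) +
        {x : unitInterval × Bool | x.1 ∈ Set.Ico w t}.indicator (fun _ => (2 : ℝ)) x) +
        ((t : ℝ) - w) := by
    intro x
    have hy := abs_le.1 (abs_outcome_sub_le x.2 t)
    have hy' := abs_le.1 (abs_outcome_sub_le x.2 w)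
    by_cases h1 : w ≤ x.1
    · by_cases h2 : t ≤ x.1
      · have : x ∉ {x : unitInterval × Bool | x.1 ∈ Set.Ico w t} := fun h => not_le.2 h.2 h2
        simp only [setSign, Set.mem_Ici, h1, h2, if_true, Set.indicator_of_notMem this]
        linarith
      · have : x ∈ {x : unitInterval × Bool | x.1 ∈ Set.Ico w t} := ⟨h1, not_le.1 h2⟩
        simp only [setSign, Set.mem_Ici, h1, h2, if_true, if_false, Set.indicator_of_mem this]
        linarith
    · have h2 : ¬ t ≤ x.1 := fun h => h1 (hwt.trans h)
      have : x ∉ {x : unitInterval × Bool | x.1 ∈ Set.Ico w t} := fun h => h1 h.1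
      simp only [setSign, Set.mem_Ici, h1, h2, if_false, Set.indicator_of_notMem this]
      linarith
  have h := integral_mono (hS t) (((hS w).add hI).add (integrable_const ((t : ℝ) - w))) hpt
  refine h.trans (le_of_eq ?_)
  have e1 := integral_add ((hS w).add hI) (integrable_const (μ := J) ((t : ℝ) - w))
  have e2 := integral_add (hS w) hI
  simp only [Pi.add_apply] at e1 e2 ⊢
  rw [e1, e2, integral_indicator_const _ hms, map_measureReal_apply measurable_fst
    measurableSet_Ico]
  simp only [integral_const, probReal_univ, smul_eq_mul, corr, one_mul]
  rw [mul_comm]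
  rfl

variable {m N Q M n : ℕ}

/-- What one batch consumes: examples for the thresholds, samples for the calls, and examples for
the estimates. -/
abbrev Batch (N Q M n : ℕ) (Y : Type*) : Type _ :=
  ((Fin M → unitInterval × Bool) × (Fin N × Fin Q → Y)) × (Fin n → unitInterval × Bool)

/-- The law of a batch. -/
def batchLaw (N Q M n : ℕ) {Y : Type*} [MeasurableSpace Y] (J : Measure (unitInterval × Bool))
    (ν : Measure Y) : Measure (Batch N Q M n Y) :=
  ((Measure.pi fun _ => J).prod (Measure.pi fun _ => ν)).prod (Measure.pi fun _ => J)

instance {Y : Type*} [MeasurableSpace Y] (J : Measure (unitInterval × Bool))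
    [IsProbabilityMeasure J] (ν : Measure Y) [IsProbabilityMeasure ν] :
    IsProbabilityMeasure (batchLaw N Q M n J ν) := by
  unfold batchLaw; infer_instance

/-- The empirical correlation, up to normalization. -/
def corrSum (x : Fin n → unitInterval × Bool) (v : ℝ) (f : unitInterval → ℝ) : ℝ :=
  ∑ b, f (x b).1 * (outcome (x b).2 - v)

/-- The candidate thresholds of a batch. -/
def candidate (x : Fin M → unitInterval × Bool) : Fin M ⊕ Fin N → unitInterval
  | .inl a => (x a).1
  | .inr i => grid N i

/-- A batch rejects if some hypothesis appears to gain at least `θ` over some nearby threshold. -/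
def batchRejects (hyp : Fin N × Fin Q → unitInterval → Bool)
    (net : Fin M → unitInterval × Bool) (x : Fin n → unitInterval × Bool) (θ : ℝ) : Prop :=
  ∃ (c : Fin N × Fin Q) (s : Fin M ⊕ Fin N), candidate net s ≤ grid N c.1 ∧
    (grid N c.1 : ℝ) - 1 / N ≤ candidate (N := N) net s ∧
    n * θ + corrSum x (candidate (N := N) net s) (setSign (Set.Ici (candidate net s))) ≤
      corrSum x (grid N c.1) (fun p => signVal (hyp c p))

/-- The hypotheses of a batch. -/
def batchHyp (AL : Learner.{u} m)
    (d : Fin N × Fin Q → (Fin m → (unitInterval × Bool) × unitInterval) × AL.Ω)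
    (c : Fin N × Fin Q) : unitInterval → Bool :=
  callHyp AL (grid N c.1) (d c)

/-- The calls of a batch. -/
abbrev CallSample (AL : Learner.{u} m) : Type _ :=
  (Fin m → (unitInterval × Bool) × unitInterval) × AL.Ω

/-- Some estimate of a batch is off by `τ`. -/
def inaccurate (AL : Learner.{u} m) (J : Measure (unitInterval × Bool)) (τ : ℝ) :
    Set (Batch N Q M n (CallSample AL)) :=
  (⋃ c : Fin N × Fin Q, {b | n * τ ≤ |corrSum b.2 (grid N c.1)
      (fun p => signVal (batchHyp AL b.1.2 c p)) -
    n * corr J (grid N c.1) (fun p => signVal (batchHyp AL b.1.2 c p))|}) ∪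
  ⋃ s : Fin M ⊕ Fin N, {b | n * τ ≤ |corrSum b.2 (candidate (N := N) b.1.1 s)
      (setSign (Set.Ici (candidate b.1.1 s))) -
    n * corr J (candidate (N := N) b.1.1 s) (setSign (Set.Ici (candidate b.1.1 s)))|}

lemma hoeffding_batch {Y Θ : Type*} [MeasurableSpace Y] [MeasurableSpace Θ]
    (J : Measure (unitInterval × Bool)) [IsProbabilityMeasure J] (ν : Measure Y)
    [IsProbabilityMeasure ν] (π : Measure Θ) [IsProbabilityMeasure π]
    {proj : (Fin M → unitInterval × Bool) × (Fin N × Fin Q → Y) → Θ}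
    (hproj : MeasurePreserving proj ((Measure.pi fun _ => J).prod (Measure.pi fun _ => ν)) π)
    {f : Θ → unitInterval × Bool → ℝ} (hf : Measurable (Function.uncurry f))
    (hb : ∀ θ z, |f θ z| ≤ 1) {τ : ℝ} (hτ : 0 ≤ τ) :
    batchLaw N Q M n J ν {b | n * τ ≤ |∑ j, f (proj b.1) (b.2 j) -
      n * ∫ z, f (proj b.1) z ∂J|} ≤ ENNReal.ofReal (2 * Real.exp (-(n * τ ^ 2 / 2))) := by
  have h1 := hoeffding_prod (ι := Fin n) J π hf hb hτ
  simp only [Fintype.card_fin] at h1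
  have h2 : MeasurePreserving (Prod.map proj id) (batchLaw N Q M n J ν)
      (π.prod (Measure.pi fun _ : Fin n => J)) :=
    hproj.prod (MeasurePreserving.id _)
  exact (measure_preimage_le_of_preserving h2 {x : Θ × (Fin n → unitInterval × Bool) |
    n * τ ≤ |∑ b, f x.1 (x.2 b) - n * ∫ z, f x.1 z ∂J|}).trans h1

/-- Every hypothesis and candidate is independent of the evaluation examples. Conditionally on it,
its estimate obeys Hoeffding's inequality, and the union bound runs over `N * Q` hypotheses and `M +
N` candidates. -/
lemma inaccurate_le (AL : Learner.{u} m) (J : Measure (unitInterval × Bool))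
    [IsProbabilityMeasure J] {τ : ℝ} (hτ : 0 ≤ τ) :
    batchLaw N Q M n J (callLaw AL J) (inaccurate AL J τ) ≤
      ((N * Q + (M + N) : ℕ) : ENNReal) * ENNReal.ofReal (2 * Real.exp (-(n * τ ^ 2 / 2))) := by
  have hsign : Measurable (fun z : unitInterval × (unitInterval × Bool) =>
      setSign (Set.Ici z.1) z.2.1) := by
    have e : (fun z : unitInterval × (unitInterval × Bool) => setSign (Set.Ici z.1) z.2.1) =
        fun z => if z.1 ≤ z.2.1 then (1 : ℝ) else -1 := by
      funext z
      by_cases h : z.1 ≤ z.2.1 <;> simp [setSign, h]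
    rw [e]
    exact Measurable.ite (measurableSet_le measurable_fst (measurable_fst.comp measurable_snd))
      measurable_const measurable_const
  have hout : Measurable (fun z : unitInterval × (unitInterval × Bool) => outcome z.2.2 - z.1) :=
    (measurable_outcome.comp (measurable_snd.comp measurable_snd)).sub
      (measurable_subtype_coe.comp measurable_fst)
  have bd : ∀ (a : ℝ) (y : Bool) (v : unitInterval), |a| ≤ 1 → |a * (outcome y - v)| ≤ 1 := by
    intro a y v ha
    rw [abs_mul]
    exact mul_le_one₀ ha (abs_nonneg _) (abs_outcome_sub_le _ _)
  have hcall : ∀ c : Fin N × Fin Q, batchLaw N Q M n J (callLaw AL J)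
      {b | n * τ ≤ |corrSum b.2 (grid N c.1) (fun p => signVal (batchHyp AL b.1.2 c p)) -
        n * corr J (grid N c.1) (fun p => signVal (batchHyp AL b.1.2 c p))|} ≤
      ENNReal.ofReal (2 * Real.exp (-(n * τ ^ 2 / 2))) := by
    intro c
    refine hoeffding_batch J (callLaw AL J) (callLaw AL J) (proj := fun w => w.2 c) ?_
      (f := fun θ z => signVal (callHyp AL (grid N c.1) θ z.1) * (outcome z.2 - grid N c.1))
      ?_ (fun θ z => bd _ _ _ (abs_signVal _).le) hτ
    · exact (measurePreserving_eval _ c).comp measurePreserving_snd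
    · refine Measurable.mul (measurable_signVal.comp ?_)
        ((measurable_outcome.comp (measurable_snd.comp measurable_snd)).sub_const _)
      exact (measurable_callHyp AL (grid N c.1)).comp
        (measurable_fst.prodMk (measurable_fst.comp measurable_snd))
  have hthr : ∀ s : Fin M ⊕ Fin N, batchLaw N Q M n J (callLaw AL J)
      {b | n * τ ≤ |corrSum b.2 (candidate (N := N) b.1.1 s)
        (setSign (Set.Ici (candidate b.1.1 s))) - n * corr J (candidate (N := N) b.1.1 s)
          (setSign (Set.Ici (candidate b.1.1 s)))|} ≤
      ENNReal.ofReal (2 * Real.exp (-(n * τ ^ 2 / 2))) := by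
    rintro (a | i)
    · refine hoeffding_batch J (callLaw AL J) J (proj := fun w => w.1 a) ?_
        (f := fun θ z => setSign (Set.Ici θ.1) z.1 * (outcome z.2 - θ.1))
        ?_ (fun θ z => bd _ _ _ (abs_setSign _ _).le) hτ
      · exact (measurePreserving_eval _ a).comp measurePreserving_fst
      · exact (hsign.mul hout).comp
          ((measurable_fst.comp measurable_fst).prodMk measurable_snd)
    · refine hoeffding_batch J (callLaw AL J) _ (proj := id) (MeasurePreserving.id _)
        (f := fun _ z => setSign (Set.Ici (grid N i)) z.1 * (outcome z.2 - grid N i))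
        ?_ (fun θ z => bd _ _ _ (abs_setSign _ _).le) hτ
      exact (hsign.mul hout).comp (measurable_const.prodMk measurable_snd)
  refine (measure_union_le _ _).trans ?_
  rw [Nat.cast_add, add_mul]
  refine add_le_add ?_ ?_
  · refine (measure_iUnion_fintype_le _ _).trans ((Finset.sum_le_sum fun c _ => hcall c).trans ?_)
    simp
  · refine (measure_iUnion_fintype_le _ _).trans ((Finset.sum_le_sum fun s _ => hthr s).trans ?_)
    simp

/-- Apparent gains exceed `α - 3ε` by at most `ε/12` for the grid and `ε/16` for each of two
estimates. The total `5ε/24` is below the margin `3ε/8` to the rejection level. -/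
lemma not_batchRejects_of_accurate (AL : Learner.{u} m) (J : Measure (unitInterval × Bool))
    [IsProbabilityMeasure J] {α ε : ℝ} (hε : 0 < ε) (hn : 0 < n) (hNε : 1 / (N : ℝ) ≤ ε / 12)
    {b : Batch N Q M n (CallSample AL)} (hb : b ∉ inaccurate AL J (ε / 16))
    (hgain : ∀ (v : ℝ) (c : CallSample AL) (t : unitInterval),
      gain J (fun p => signVal (callHyp AL v c p)) (Set.Ici t) t ≤ α - 3 * ε) :
    ¬ batchRejects (batchHyp AL b.1.2) b.1.1 b.2 (α - 21 / 8 * ε) := by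
  rintro ⟨c, s, h1, h2, h3⟩
  have hn' : (0 : ℝ) < n := by exact_mod_cast hn
  simp only [inaccurate, Set.mem_union, Set.mem_iUnion, Set.mem_ofPred_eq, not_or, not_exists,
    not_le] at hb
  have hA := (abs_lt.1 (hb.1 c)).2
  have hB := (abs_lt.1 (hb.2 s)).1
  set t := candidate (N := N) b.1.1 s with ht
  set h : unitInterval → ℝ := fun p => signVal (batchHyp AL b.1.2 c p) with hh
  have hhm : Measurable h := measurable_signVal.comp (measurable_callHyp_apply AL _ _)
  have hhb : ∀ p, |h p| ≤ 1 := fun p => (abs_signVal _).le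
  have g1 := hgain (grid N c.1) (b.1.2 c) t
  rw [← corr_sub_corr J (f := fun p => signVal (callHyp AL (grid N c.1) (b.1.2 c) p)) hhm hhb]
    at g1
  have g2 : corr J (grid N c.1) h ≤ corr J t h + |(t : ℝ) - grid N c.1| :=
    corr_le_corr_add J hhm hhb t (grid N c.1)
  have g3 : |(t : ℝ) - grid N c.1| ≤ 1 / N := by
    have : (t : ℝ) ≤ grid N c.1 := h1
    rw [abs_le]; constructor <;> linarith
  have g4 : corr J (grid N c.1) h - corr J t (setSign (Set.Ici t)) ≤ α - 3 * ε + ε / 12 := by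
    have : corr J t h - corr J t (setSign (Set.Ici t)) ≤ α - 3 * ε := g1
    linarith
  have g5 : (n : ℝ) * (corr J (grid N c.1) h - corr J t (setSign (Set.Ici t))) ≤
      n * (α - 3 * ε + ε / 12) := mul_le_mul_of_nonneg_left g4 hn'.le
  have g6 : (0 : ℝ) < n * ε := mul_pos hn' hε
  nlinarith

/-- From the true gain `α` one loses `2ε` to the learner, `ε/4` to the mass between `w` and the
candidate, `ε/6` to two moves of at most `1/N`, and `ε/8` to two estimates. The sum is below
`21ε/8`. -/
lemma batchRejects_of_accurate (AL : Learner.{u} m) (J : Measure (unitInterval × Bool))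
    [IsProbabilityMeasure J] {α ε : ℝ} (hε : 0 < ε) (hn : 0 < n) (hNε : 1 / (N : ℝ) ≤ ε / 12)
    {b : Batch N Q M n (CallSample AL)} (hb : b ∉ inaccurate AL J (ε / 16))
    {f : unitInterval → ℝ} (hf : Measurable f) (hfb : ∀ p, |f p| ≤ 1) {w : unitInterval}
    (hgain : α < gain J f (Set.Ici w) w) {c : Fin N × Fin Q}
    (hw : (grid N c.1 : ℝ) - 1 / N ≤ w)
    (hc : corr J (grid N c.1) f - 2 * ε ≤
      corr J (grid N c.1) (fun p => signVal (batchHyp AL b.1.2 c p)))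
    {s : Fin M ⊕ Fin N} (hs1 : w ≤ candidate (N := N) b.1.1 s)
    (hs2 : candidate (N := N) b.1.1 s ≤ grid N c.1)
    (hs3 : (J.map Prod.fst).real (Set.Ico w (candidate (N := N) b.1.1 s)) ≤ ε / 8) :
    batchRejects (batchHyp AL b.1.2) b.1.1 b.2 (α - 21 / 8 * ε) := by
  have hn' : (0 : ℝ) < n := by exact_mod_cast hn
  simp only [inaccurate, Set.mem_union, Set.mem_iUnion, Set.mem_ofPred_eq, not_or, not_exists,
    not_le] at hb
  have hA := (abs_lt.1 (hb.1 c)).1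
  have hB := (abs_lt.1 (hb.2 s)).2
  set t := candidate (N := N) b.1.1 s with ht
  have hs1' : (w : ℝ) ≤ t := hs1
  have hs2' : (t : ℝ) ≤ grid N c.1 := hs2
  refine ⟨c, s, hs2, by linarith, ?_⟩
  rw [← ht]
  set h : unitInterval → ℝ := fun p => signVal (batchHyp AL b.1.2 c p) with hh
  rw [← corr_sub_corr J hf hfb] at hgain
  have g1 := corr_threshold_le J hs1
  have g2 := corr_le_corr_add J hf hfb (grid N c.1) w
  have g3 : |(grid N c.1 : ℝ) - w| ≤ 1 / N := by
    rw [abs_le]; constructor <;> linarith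
  have g4 : α - 2 * ε - ε / 4 - ε / 6 ≤
      corr J (grid N c.1) h - corr J t (setSign (Set.Ici t)) := by
    linarith
  have g5 : (n : ℝ) * (α - 2 * ε - ε / 4 - ε / 6) ≤
      n * (corr J (grid N c.1) h - corr J t (setSign (Set.Ici t))) :=
    mul_le_mul_of_nonneg_left g4 hn'.le
  have g6 : (0 : ℝ) < n * ε := mul_pos hn' hε
  nlinarith

/-- The failure probability of a batch. -/
def batchFailure (N Q M n : ℕ) (ε : ℝ) : ENNReal :=
  ENNReal.ofReal (Real.exp (-(ε / 8 * M))) + ENNReal.ofReal (1 / 10) ^ Q +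
    ((N * Q + (M + N) : ℕ) : ENNReal) * ENNReal.ofReal (2 * Real.exp (-(n * (ε / 16) ^ 2 / 2)))

lemma batch_rejects_bad_le (AL : Learner.{u} m) (J : Measure (unitInterval × Bool))
    [IsProbabilityMeasure J] {α ε : ℝ} (hε : 0 < ε) (hn : 0 < n)
    (hNε : 1 / (N : ℝ) ≤ ε / 12)
    (hgain : ∀ (v : ℝ) (c : CallSample AL) (t : unitInterval),
      gain J (fun p => signVal (callHyp AL v c p)) (Set.Ici t) t ≤ α - 3 * ε) :
    batchLaw N Q M n J (callLaw AL J)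
      {b | batchRejects (batchHyp AL b.1.2) b.1.1 b.2 (α - 21 / 8 * ε)} ≤
      batchFailure N Q M n ε := by
  refine le_trans (measure_mono fun b hb => ?_)
    ((inaccurate_le AL J (τ := ε / 16) (by positivity)).trans le_add_self)
  by_contra h
  exact not_batchRejects_of_accurate AL J hε hn hNε h hgain hb

lemma all_calls_fail_le {Y : Type*} [MeasurableSpace Y] (ν : Measure Y) [IsProbabilityMeasure ν]
    (bad : Set Y) {c : ENNReal} (hc : ν bad ≤ c) (i : Fin N) :
    (Measure.pi fun _ : Fin N × Fin Q => ν) {d | ∀ q, d (i, q) ∈ bad} ≤ c ^ Q := by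
  have : {d : Fin N × Fin Q → Y | ∀ q, d (i, q) ∈ bad} =
      Set.univ.pi fun h => if h.1 = i then bad else Set.univ := by
    ext d
    simp only [Set.mem_ofPred_eq, Set.mem_pi, Set.mem_univ, true_implies]
    constructor
    · rintro h ⟨j, q⟩
      by_cases hj : j = i
      · subst hj; simpa using h q
      · simp [hj]
    · intro h q
      simpa using h (i, q)
  rw [this, Measure.pi_pi]
  have h1 : ∀ h : Fin N × Fin Q, ν (if h.1 = i then bad else Set.univ) =
      if h.1 = i then ν bad else 1 := by
    intro h; split_ifs <;> simp
  simp_rw [h1]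
  have h2 : (∏ j : Fin N, ∏ _ : Fin Q, if j = i then ν bad else 1) = ν bad ^ Q := by
    simp
  rw [Fintype.prod_prod_type]
  exact h2.le.trans (pow_le_pow_left' hc Q)

/-- A wrong acceptance requires one of three events, matching the summands of `batchFailure`: no
candidate close to `w` in mass, failure of all `Q` calls at the grid point just above `w`, or an
inaccurate estimate. -/
lemma batch_accepts_bad_le (AL : Learner.{u} m) (J : Measure (unitInterval × Bool))
    [IsProbabilityMeasure J] {α ε : ℝ} (hε : 0 < ε) (hn : 0 < n) (hN : 0 < N)
    (hNε : 1 / (N : ℝ) ≤ ε / 12) {F : Set (unitInterval → Bool)} (hAL : AL.IsAgnostic ε F)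
    {f : unitInterval → Bool} (hf : Measurable f) (hfF : f ∈ F) {w : unitInterval}
    (hgain : α < gain J (fun p => signVal (f p)) (Set.Ici w) w) :
    batchLaw N Q M n J (callLaw AL J)
      {b | ¬ batchRejects (batchHyp AL b.1.2) b.1.1 b.2 (α - 21 / 8 * ε)} ≤
      batchFailure N Q M n ε := by
  obtain ⟨i, hi1, hi2⟩ := exists_grid hN w
  have : IsProbabilityMeasure (J.map Prod.fst) :=
    Measure.isProbabilityMeasure_map measurable_fst.aemeasurable
  obtain ⟨miss, hmiss, hnet⟩ : ∃ miss : Set (Fin M → unitInterval × Bool),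
      (Measure.pi fun _ => J) miss ≤ ENNReal.ofReal (Real.exp (-(ε / 8 * M))) ∧
      ∀ x ∉ miss, ∃ s, w ≤ candidate (N := N) x s ∧ candidate (N := N) x s ≤ grid N i ∧
        (J.map Prod.fst).real (Set.Ico w (candidate (N := N) x s)) ≤ ε / 8 := by
    -- If the interval up to the grid point is already light, the grid point itself is the
    -- candidate; otherwise a sampled prediction is needed, and one is missed with exponentially
    -- small probability.
    rcases exists_quantile (J.map Prod.fst) (ENNReal.ofReal (ε / 8)) hi1 with h | ⟨v, hv, h1, h2⟩
    · refine ⟨∅, by simp, fun x _ => ⟨Sum.inr i, hi1, le_rfl, ?_⟩⟩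
      exact ENNReal.toReal_le_of_le_ofReal (by positivity) h
    · refine ⟨{x | ∀ a, x a ∉ Prod.fst ⁻¹' Set.Icc w v}, ?_, fun x hx => ?_⟩
      · rw [Measure.map_apply measurable_fst measurableSet_Icc] at h2
        have := miss_bound (ι := Fin M) J (measurable_fst measurableSet_Icc)
          (c := ε / 8) (by positivity) h2
        simpa only [Fintype.card_fin] using this
      · simp only [Set.mem_ofPred_eq, not_forall, not_not] at hx
        obtain ⟨a, ha⟩ := hx
        refine ⟨Sum.inl a, ha.1, ha.2.trans hv.2, ?_⟩
        refine ENNReal.toReal_le_of_le_ofReal (by positivity) (le_trans (measure_mono ?_) h1)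
        exact Set.Ico_subset_Ico_right ha.2
  set bad : Set (CallSample AL) := {c | corr J (grid N i) (fun p => signVal
    (callHyp AL (grid N i) c p)) < corr J (grid N i) (fun p => signVal (f p)) - 2 * ε} with hbad
  have hsub : {b : Batch N Q M n (CallSample AL) |
      ¬ batchRejects (batchHyp AL b.1.2) b.1.1 b.2 (α - 21 / 8 * ε)} ⊆
      ((fun b => b.1.1) ⁻¹' miss ∪ (fun b => b.1.2) ⁻¹' {d | ∀ q, d (i, q) ∈ bad}) ∪
        inaccurate AL J (ε / 16) := by
    intro b hb
    by_contra hno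
    simp only [Set.mem_union, not_or, Set.mem_preimage] at hno
    obtain ⟨⟨h1, h2⟩, h3⟩ := hno
    simp only [Set.mem_ofPred_eq, not_forall] at h2
    obtain ⟨q, hq⟩ := h2
    obtain ⟨s, hs1, hs2, hs3⟩ := hnet _ h1
    exact hb (batchRejects_of_accurate AL J hε hn hNε h3 (measurable_signVal.comp hf)
      (fun p => (abs_signVal _).le) hgain (c := (i, q)) hi2 (not_lt.1 hq) hs1 hs2 hs3)
  refine (measure_mono hsub).trans ((measure_union_le _ _).trans (add_le_add
    ((measure_union_le _ _).trans (add_le_add ?_ ?_)) (inaccurate_le AL J (by positivity))))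
  · exact (measure_preimage_le_of_preserving (f := fun b : Batch N Q M n (CallSample AL) => b.1.1)
      (measurePreserving_fst.comp measurePreserving_fst) miss).trans hmiss
  · exact (measure_preimage_le_of_preserving (f := fun b : Batch N Q M n (CallSample AL) => b.1.2)
      (measurePreserving_snd.comp measurePreserving_fst) _).trans
      (all_calls_fail_le _ _ (callLaw_bad_le AL hAL J (grid N i) hf hfF) i)

end

section

/-! ### Compiling formulas to straight-line programs -/

/-- Arithmetic formulas over registers, examples and hypotheses. -/
inductive Formula (n N : ℕ) : Type
  | const (c : ℝ)
  | reg (k : ℕ)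
  | prediction (i : Fin n)
  | outcome (i : Fin n)
  | add (a b : Formula n N)
  | sub (a b : Formula n N)
  | mul (a b : Formula n N)
  | le (a b : Formula n N)
  | hyp (j : Fin N) (a : Formula n N)

namespace Formula

variable {n N : ℕ}

/-- The value of a formula, given the registers `R`. -/
def eval (x : Fin n → unitInterval × Bool) (h : Fin N → unitInterval → Bool) (R : ℕ → ℝ) :
    Formula n N → ℝ
  | const c => c
  | reg k => R k
  | prediction i => (x i).1
  | outcome i => CalDec.outcome (x i).2
  | add a b => eval x h R a + eval x h R b
  | sub a b => eval x h R a - eval x h R b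
  | mul a b => eval x h R a * eval x h R b
  | le a b => if eval x h R a ≤ eval x h R b then 1 else 0
  | hyp j a => signVal (h j (Set.projIcc (0 : ℝ) 1 zero_le_one (eval x h R a)))

/-- The formula reads only registers below `b`. -/
def Below (b : ℕ) : Formula n N → Prop
  | reg k => k < b
  | add s t => Below b s ∧ Below b t
  | sub s t => Below b s ∧ Below b t
  | mul s t => Below b s ∧ Below b t
  | le s t => Below b s ∧ Below b t
  | hyp _ s => Below b s
  | _ => True

/-- A program that computes the formula in register `b`, using registers from `b` on. -/
def compile : Formula n N → ℕ → List (Instr n N)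
  | const c, b => [.const b c]
  | reg k, b => [.const b 0, .add b b k]
  | prediction i, b => [.prediction b i]
  | outcome i, b => [.outcome b i]
  | add s t, b => compile s b ++ compile t (b + 1) ++ [.add b b (b + 1)]
  | sub s t, b => compile s b ++ compile t (b + 1) ++ [.sub b b (b + 1)]
  | mul s t, b => compile s b ++ compile t (b + 1) ++ [.mul b b (b + 1)]
  | le s t, b => compile s b ++ compile t (b + 1) ++ [.le b b (b + 1)]
  | hyp j s, b => compile s b ++ [.hyp b j b]

/-- The length of the compiled program. -/
def cost : Formula n N → ℕ
  | const _ => 1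
  | reg _ => 2
  | prediction _ => 1
  | outcome _ => 1
  | add s t => cost s + cost t + 1
  | sub s t => cost s + cost t + 1
  | mul s t => cost s + cost t + 1
  | le s t => cost s + cost t + 1
  | hyp _ s => cost s + 1

lemma length_compile (e : Formula n N) (b : ℕ) : (e.compile b).length = e.cost := by
  induction e generalizing b <;> simp_all [compile, cost, add_assoc]

lemma Below.mono {b c : ℕ} (hbc : b ≤ c) {e : Formula n N} (h : e.Below b) : e.Below c := by
  induction e with
  | reg k => exact lt_of_lt_of_le h hbc
  | add s t hs ht => exact ⟨hs h.1, ht h.2⟩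
  | sub s t hs ht => exact ⟨hs h.1, ht h.2⟩
  | mul s t hs ht => exact ⟨hs h.1, ht h.2⟩
  | le s t hs ht => exact ⟨hs h.1, ht h.2⟩
  | hyp j s hs => exact hs h
  | _ => trivial

lemma eval_congr (x : Fin n → unitInterval × Bool) (h : Fin N → unitInterval → Bool)
    {R R' : ℕ → ℝ} {b : ℕ} (hR : ∀ k < b, R k = R' k) {e : Formula n N} (he : e.Below b) :
    e.eval x h R = e.eval x h R' := by
  induction e with
  | reg k => exact hR k he
  | add s t hs ht => simp only [eval, hs he.1, ht he.2]
  | sub s t hs ht => simp only [eval, hs he.1, ht he.2]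
  | mul s t hs ht => simp only [eval, hs he.1, ht he.2]
  | le s t hs ht => simp only [eval, hs he.1, ht he.2]
  | hyp j s hs => simp only [eval, hs he]
  | _ => rfl

lemma runProgram_append (x : Fin n → unitInterval × Bool) (h : Fin N → unitInterval → Bool)
    (p q : List (Instr n N)) (R : ℕ → ℝ) :
    runProgram x h (p ++ q) R = runProgram x h q (runProgram x h p R) :=
  List.foldl_append

/-- Registers are used as a stack. Code placed at `b` never touches registers below `b`, so the
first operand survives in `b` while the second is computed in `b + 1`. The second conclusion carries
the induction. -/
lemma compile_spec (x : Fin n → unitInterval × Bool) (h : Fin N → unitInterval → Bool)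
    (e : Formula n N) : ∀ (b : ℕ) (R : ℕ → ℝ), e.Below b →
    runProgram x h (e.compile b) R b = e.eval x h R ∧
      ∀ k < b, runProgram x h (e.compile b) R k = R k := by
  have bin : ∀ (s t : Formula n N) (i : ℕ → Instr n N) (op : ℝ → ℝ → ℝ),
      (∀ b R, (i b).exec x h R = Function.update R b (op (R b) (R (b + 1)))) →
      (∀ (b : ℕ) (R : ℕ → ℝ), s.Below b → runProgram x h (s.compile b) R b = s.eval x h R ∧
        ∀ k < b, runProgram x h (s.compile b) R k = R k) →
      (∀ (b : ℕ) (R : ℕ → ℝ), t.Below b → runProgram x h (t.compile b) R b = t.eval x h R ∧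
        ∀ k < b, runProgram x h (t.compile b) R k = R k) →
      ∀ (b : ℕ) (R : ℕ → ℝ), s.Below b → t.Below b →
      runProgram x h (s.compile b ++ t.compile (b + 1) ++ [i b]) R b =
        op (s.eval x h R) (t.eval x h R) ∧
      ∀ k < b, runProgram x h (s.compile b ++ t.compile (b + 1) ++ [i b]) R k = R k := by
    intro s t i op hi hs ht b R hsb htb
    obtain ⟨s1, s2⟩ := hs b R hsb
    obtain ⟨t1, t2⟩ := ht (b + 1) (runProgram x h (s.compile b) R) (htb.mono b.le_succ)
    have e1 := eval_congr x h s2 htb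
    rw [runProgram_append, runProgram_append]
    have hstep : ∀ R' : ℕ → ℝ, runProgram x h [i b] R' =
        Function.update R' b (op (R' b) (R' (b + 1))) := fun R' => hi b R'
    rw [hstep]
    refine ⟨?_, fun k hk => ?_⟩
    · rw [Function.update_self, t1, t2 b b.lt_succ_self, s1, e1]
    · rw [Function.update_of_ne hk.ne, t2 k (hk.trans b.lt_succ_self), s2 k hk]
  induction e with
  | const c =>
    intro b R _
    exact ⟨Function.update_self .., fun k hk => Function.update_of_ne hk.ne _ _⟩
  | prediction i =>
    intro b R _
    exact ⟨Function.update_self .., fun k hk => Function.update_of_ne hk.ne _ _⟩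
  | outcome i =>
    intro b R _
    exact ⟨Function.update_self .., fun k hk => Function.update_of_ne hk.ne _ _⟩
  | reg k =>
    intro b R hk
    have hk' : k < b := hk
    simp only [compile, runProgram, List.foldl, Instr.exec, eval]
    refine ⟨?_, fun j hj => ?_⟩
    · rw [Function.update_self, Function.update_self, Function.update_of_ne hk'.ne, zero_add]
    · rw [Function.update_of_ne hj.ne, Function.update_of_ne hj.ne]
  | add s t hs ht =>
    exact fun b R hb => bin s t (fun b => .add b b (b + 1)) (fun u v => u + v)
      (fun _ _ => rfl) hs ht b R hb.1 hb.2
  | sub s t hs ht =>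
    exact fun b R hb => bin s t (fun b => .sub b b (b + 1)) (fun u v => u - v)
      (fun _ _ => rfl) hs ht b R hb.1 hb.2
  | mul s t hs ht =>
    exact fun b R hb => bin s t (fun b => .mul b b (b + 1)) (fun u v => u * v)
      (fun _ _ => rfl) hs ht b R hb.1 hb.2
  | le s t hs ht =>
    exact fun b R hb => bin s t (fun b => .le b b (b + 1)) (fun u v => if u ≤ v then 1 else 0)
      (fun _ _ => rfl) hs ht b R hb.1 hb.2
  | hyp j s hs =>
    intro b R hb
    obtain ⟨s1, s2⟩ := hs b R hb
    simp only [compile, eval]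
    rw [runProgram_append]
    refine ⟨?_, fun k hk => ?_⟩
    · rw [← s1]; exact Function.update_self ..
    · rw [← s2 k hk]; exact Function.update_of_ne hk.ne _ _

/-- The sum of a finite family of formulas. -/
def sum {α : Type*} [Fintype α] (f : α → Formula n N) : Formula n N :=
  ((Finset.univ : Finset α).toList.map f).foldr add (const 0)

lemma eval_sum {α : Type*} [Fintype α] (f : α → Formula n N) (x : Fin n → unitInterval × Bool)
    (h : Fin N → unitInterval → Bool) (R : ℕ → ℝ) :
    (sum f).eval x h R = ∑ a, (f a).eval x h R := by
  rw [← Finset.sum_map_toList, sum]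
  induction (Finset.univ : Finset α).toList with
  | nil => rfl
  | cons a l ih =>
    simp only [List.map_cons, List.foldr_cons, eval, ih, List.sum_cons]

lemma below_sum {α : Type*} [Fintype α] {f : α → Formula n N} {b : ℕ} (h : ∀ a, (f a).Below b) :
    (sum f).Below b := by
  rw [sum]
  induction (Finset.univ : Finset α).toList with
  | nil => trivial
  | cons a l ih => exact ⟨h a, ih⟩

lemma cost_sum_le {α : Type*} [Fintype α] {f : α → Formula n N} {c : ℕ}
    (h : ∀ a, (f a).cost ≤ c) : (sum f).cost ≤ Fintype.card α * (c + 1) + 1 := by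
  rw [sum, ← Finset.card_univ, ← Finset.length_toList]
  induction (Finset.univ : Finset α).toList with
  | nil => simp [cost]
  | cons a l ih =>
    have := h a
    simp only [List.map_cons, List.foldr_cons, cost, List.length_cons]
    rw [add_mul]
    omega

/-- Computes the formulas in consecutive registers from `b` on. -/
def compileAll : List (Formula n N) → ℕ → List (Instr n N)
  | [], _ => []
  | e :: l, b => e.compile b ++ compileAll l (b + 1)

/-- The formulas read no registers, so scratch values left by earlier ones are harmless, and each
result lies below the area used by the later ones. -/
lemma compileAll_spec (x : Fin n → unitInterval × Bool) (h : Fin N → unitInterval → Bool)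
    (l : List (Formula n N)) (hl : ∀ e ∈ l, e.Below 0) (b : ℕ) (R : ℕ → ℝ) :
    (∀ (j : ℕ) (hj : j < l.length), runProgram x h (compileAll l b) R (b + j) =
      l[j].eval x h fun _ => 0) ∧
      ∀ k < b, runProgram x h (compileAll l b) R k = R k := by
  induction l generalizing b R with
  | nil => exact ⟨fun j hj => absurd hj (Nat.not_lt_zero j), fun _ _ => rfl⟩
  | cons e l ih =>
    have he := hl e (List.mem_cons_self ..)
    obtain ⟨e1, e2⟩ := compile_spec x h e b R (he.mono (Nat.zero_le b))
    obtain ⟨l1, l2⟩ := ih (fun e' he' => hl e' (List.mem_cons_of_mem _ he')) (b + 1)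
      (runProgram x h (e.compile b) R)
    simp only [compileAll]
    rw [runProgram_append]
    refine ⟨fun j hj => ?_, fun k hk => ?_⟩
    · cases j with
      | zero =>
        rw [add_zero, l2 b b.lt_succ_self, e1]
        exact eval_congr x h (fun k hk => absurd hk (Nat.not_lt_zero k)) he
      | succ j =>
        have := l1 j (by simpa using hj)
        rw [show b + (j + 1) = b + 1 + j by ring, this]
        rfl
    · rw [l2 k (hk.trans b.lt_succ_self), e2 k hk]

lemma length_compileAll_le {l : List (Formula n N)} {c : ℕ} (h : ∀ e ∈ l, e.cost ≤ c) (b : ℕ) :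
    (compileAll l b).length ≤ l.length * c := by
  induction l generalizing b with
  | nil => simp [compileAll]
  | cons e l ih =>
    have h1 := h e (List.mem_cons_self ..)
    have h2 := ih (fun e' he' => h e' (List.mem_cons_of_mem _ he')) (b + 1)
    simp only [compileAll, List.length_append, length_compile, List.length_cons]
    rw [add_mul]
    omega

end Formula

/-! ### The audit procedure -/

variable {N Q M n ρ : ℕ}

/-- The examples of a run are the threshold examples and the evaluation examples of the batches. -/
def exampleIndex (M n ρ : ℕ) : Fin (ρ * (M + n)) ≃ Fin ρ × (Fin M ⊕ Fin n) :=
  finProdFinEquiv.symm.trans (Equiv.prodCongr (Equiv.refl _) finSumFinEquiv.symm)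

/-- The calls of a run are indexed by a batch, a grid point and a repetition. -/
def callIndex (N Q ρ : ℕ) : Fin (ρ * (N * Q)) ≃ Fin ρ × (Fin N × Fin Q) :=
  finProdFinEquiv.symm.trans (Equiv.prodCongr (Equiv.refl _) finProdFinEquiv.symm)

section formulas

variable (N Q M n ρ)

/-- A formula in the setting of the procedure. -/
abbrev AuditFormula : Type := Formula (ρ * (M + n)) (ρ * (N * Q))

/-- The threshold `s` of batch `r`. -/
def thresholdFormula (r : Fin ρ) : Fin M ⊕ Fin N → AuditFormula N Q M n ρ
  | .inl a => .prediction ((exampleIndex M n ρ).symm (r, .inl a))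
  | .inr i => .const (grid N i)

/-- The empirical correlation of the hypothesis of call `j`. -/
def callFormula (j : Fin (ρ * (N * Q))) : AuditFormula N Q M n ρ :=
  Formula.sum fun b : Fin n =>
    let k := (exampleIndex M n ρ).symm ((callIndex N Q ρ j).1, Sum.inr b)
    .mul (.hyp j (.prediction k))
      (.sub (.outcome k) (.const (grid N (callIndex N Q ρ j).2.1)))

/-- The empirical correlation of a threshold. -/
def baseFormula (u : Fin (ρ * (M + N))) : AuditFormula N Q M n ρ :=
  Formula.sum fun b : Fin n =>
    let r := (exampleIndex M N ρ u).1
    let t := thresholdFormula N Q M n ρ r (exampleIndex M N ρ u).2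
    let k := (exampleIndex M n ρ).symm (r, Sum.inr b)
    .mul (.sub (.mul (.const 2) (.le t (.prediction k))) (.const 1)) (.sub (.outcome k) t)

/-- One comparison of a hypothesis with a threshold. -/
def comparisonFormula (θ : ℝ) (r : Fin ρ) (w : (Fin N × Fin Q) × (Fin M ⊕ Fin N)) :
    AuditFormula N Q M n ρ :=
  let t := thresholdFormula N Q M n ρ r w.2
  .mul (.mul (.le t (.const (grid N w.1.1))) (.le (.const ((grid N w.1.1 : ℝ) - 1 / N)) t))
    (.le (.add (.const (n * θ)) (.reg (1 + ρ * (N * Q) + (exampleIndex M N ρ).symm (r, w.2))))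
      (.reg (1 + (callIndex N Q ρ).symm (r, w.1))))

/-- The final verdict: a majority vote of the batches. -/
def verdictFormula (θ : ℝ) (k : ℕ) : AuditFormula N Q M n ρ :=
  .sub (.const 1) (.le (.const k) (Formula.sum fun r : Fin ρ =>
    .sub (.const 1) (.le (Formula.sum (comparisonFormula N Q M n ρ θ r)) (.const 0))))

/-- Loads the label probabilities. -/
def prepareProgram : List (Instr (ρ * (M + n)) 0) :=
  Formula.compileAll (List.ofFn fun i : Fin N => .const (labelProb (grid N i) true)) 0 ++
  Formula.compileAll (List.ofFn fun i : Fin N => .const (labelProb (grid N i) false)) N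

/-- Computes all correlations and the verdict. -/
def decideProgram (θ : ℝ) (k : ℕ) : List (Instr (ρ * (M + n)) (ρ * (N * Q))) :=
  Formula.compileAll (List.ofFn (callFormula N Q M n ρ)) 1 ++
  Formula.compileAll (List.ofFn (baseFormula N Q M n ρ)) (1 + ρ * (N * Q)) ++
  (verdictFormula N Q M n ρ θ k).compile (1 + ρ * (N * Q) + ρ * (M + N)) ++
  [.const 0 0, .add 0 0 (1 + ρ * (N * Q) + ρ * (M + N))]

/-- The audit procedure. -/
def auditProcedure (θ : ℝ) (k : ℕ) : Procedure where
  extra := ρ * (M + n)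
  calls := ρ * (N * Q)
  prepare := prepareProgram N M n ρ
  prob j y := if y then (callIndex N Q ρ j).2.1 else N + (callIndex N Q ρ j).2.1
  decide := decideProgram N Q M n ρ θ k

end formulas

/-! ### Correctness of the compiled audit programs -/

lemma prepareProgram_spec (x : Fin (ρ * (M + n)) → unitInterval × Bool) (i : Fin N) (y : Bool) :
    runProgram x (fun j => j.elim0) (prepareProgram N M n ρ) (fun _ => 0)
      (if y then (i : ℕ) else N + i) = labelProb (grid N i) y := by
  have hc : ∀ (y : Bool), ∀ e ∈ (List.ofFn fun i : Fin N =>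
      (Formula.const (labelProb (grid N i) y) : Formula (ρ * (M + n)) 0)), e.Below 0 := by
    intro y e he
    obtain ⟨i, rfl⟩ := (List.mem_ofFn' ..).1 he
    trivial
  rw [prepareProgram, Formula.runProgram_append]
  cases y
  · have := (Formula.compileAll_spec x (fun j => j.elim0) _ (hc false) N
      (runProgram x (fun j => j.elim0) (Formula.compileAll (List.ofFn fun i : Fin N =>
        .const (labelProb (grid N i) true)) 0) fun _ => 0)).1 i (by simp)
    rw [if_neg (by simp), this]
    simp [Formula.eval]
  · rw [if_pos rfl, (Formula.compileAll_spec x (fun j => j.elim0) _ (hc false) N _).2 i i.isLt]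
    have := (Formula.compileAll_spec x (fun j => j.elim0) _ (hc true) 0
      (fun _ => 0)).1 i (by simp)
    rw [zero_add] at this
    rw [this]
    simp [Formula.eval]

lemma prepared_auditProcedure (θ : ℝ) (k : ℕ) (x : Fin (ρ * (M + n)) → unitInterval × Bool)
    (j : Fin (ρ * (N * Q))) (y : Bool) :
    (auditProcedure N Q M n ρ θ k).prepared x ((auditProcedure N Q M n ρ θ k).prob j y) =
      labelProb (grid N (callIndex N Q ρ j).2.1) y :=
  prepareProgram_spec x (callIndex N Q ρ j).2.1 y

lemma answer_auditProcedure {m : ℕ} (AL : Learner.{u} m) (θ : ℝ) (k : ℕ)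
    (x : Fin (ρ * (M + n)) → unitInterval × Bool) (j : Fin (ρ * (N * Q))) (d : CallSample AL) :
    (auditProcedure N Q M n ρ θ k).answer AL x j d.1 d.2 =
      callHyp AL (grid N (callIndex N Q ρ j).2.1) d := by
  unfold Procedure.answer callHyp relabel
  congr 1
  funext i
  have := prepared_auditProcedure (N := N) (Q := Q) θ k x j (d.1 i).1.2
  rw [this]

section evaluation

variable (x : Fin (ρ * (M + n)) → unitInterval × Bool)
  (h : Fin (ρ * (N * Q)) → unitInterval → Bool) (R : ℕ → ℝ)

/-- The threshold examples of batch `r`. -/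
def netPart (r : Fin ρ) (a : Fin M) : unitInterval × Bool :=
  x ((exampleIndex M n ρ).symm (r, .inl a))

/-- The evaluation examples of batch `r`. -/
def evalPart (r : Fin ρ) (b : Fin n) : unitInterval × Bool :=
  x ((exampleIndex M n ρ).symm (r, .inr b))

/-- The hypotheses of batch `r`. -/
def hypPart (r : Fin ρ) (c : Fin N × Fin Q) : unitInterval → Bool :=
  h ((callIndex N Q ρ).symm (r, c))

lemma eval_thresholdFormula (r : Fin ρ) (s : Fin M ⊕ Fin N) :
    (thresholdFormula N Q M n ρ r s).eval x h R = candidate (netPart x r) s := by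
  cases s <;> rfl

lemma eval_callFormula (j : Fin (ρ * (N * Q))) :
    (callFormula N Q M n ρ j).eval x h R = corrSum (evalPart x (callIndex N Q ρ j).1)
      (grid N (callIndex N Q ρ j).2.1) (fun p => signVal (h j p)) := by
  rw [callFormula, Formula.eval_sum, corrSum]
  refine Finset.sum_congr rfl fun b _ => ?_
  simp only [Formula.eval, evalPart, Set.projIcc_val]

lemma eval_baseFormula (u : Fin (ρ * (M + N))) :
    (baseFormula N Q M n ρ u).eval x h R = corrSum (evalPart x (exampleIndex M N ρ u).1)
      (candidate (netPart x (exampleIndex M N ρ u).1) (exampleIndex M N ρ u).2)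
      (setSign (Set.Ici (candidate (netPart x (exampleIndex M N ρ u).1)
        (exampleIndex M N ρ u).2))) := by
  rw [baseFormula, Formula.eval_sum, corrSum]
  refine Finset.sum_congr rfl fun b _ => ?_
  simp only [Formula.eval, evalPart, eval_thresholdFormula, setSign, Set.mem_Ici,
    Subtype.coe_le_coe]
  congr 1
  split_ifs <;> norm_num

/-- The registers hold the correlations. -/
def Loaded : Prop :=
  (∀ j : Fin (ρ * (N * Q)), R (1 + j) = (callFormula N Q M n ρ j).eval x h fun _ => 0) ∧
    ∀ u : Fin (ρ * (M + N)), R (1 + ρ * (N * Q) + u) = (baseFormula N Q M n ρ u).eval x h fun _ => 0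

variable {x h R}

/-- A product of three `0/1` comparisons acts as a conjunction. Nonnegativity lets a positive sum
express existence. -/
lemma eval_comparisonFormula (hR : Loaded x h R) (θ : ℝ) (r : Fin ρ)
    (w : (Fin N × Fin Q) × (Fin M ⊕ Fin N)) :
    0 ≤ (comparisonFormula N Q M n ρ θ r w).eval x h R ∧
    (0 < (comparisonFormula N Q M n ρ θ r w).eval x h R ↔
      candidate (netPart x r) w.2 ≤ grid N w.1.1 ∧
      (grid N w.1.1 : ℝ) - 1 / N ≤ candidate (N := N) (netPart x r) w.2 ∧
      n * θ + corrSum (evalPart x r) (candidate (N := N) (netPart x r) w.2)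
        (setSign (Set.Ici (candidate (netPart x r) w.2))) ≤
      corrSum (evalPart x r) (grid N w.1.1) (fun p => signVal (hypPart h r w.1 p))) := by
  have e1 := hR.1 ((callIndex N Q ρ).symm (r, w.1))
  have e2 := hR.2 ((exampleIndex M N ρ).symm (r, w.2))
  rw [eval_callFormula, Equiv.apply_symm_apply] at e1
  rw [eval_baseFormula, Equiv.apply_symm_apply] at e2
  simp only [comparisonFormula, Formula.eval, eval_thresholdFormula, e1, e2, hypPart,
    Subtype.coe_le_coe]
  constructor
  · split_ifs <;> norm_num
  · split_ifs <;> simp_all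

open Classical in
lemma eval_verdictFormula (hR : Loaded x h R) (θ : ℝ) (k : ℕ) :
    0 < (verdictFormula N Q M n ρ θ k).eval x h R ↔
      (Finset.univ.filter fun r =>
        batchRejects (hypPart h r) (netPart x r) (evalPart x r) θ).card < k := by
  have hs : ∀ r : Fin ρ, (Formula.sum (comparisonFormula N Q M n ρ θ r)).eval x h R ≤ 0 ↔
      ¬ batchRejects (hypPart h r) (netPart x r) (evalPart x r) θ := by
    intro r
    rw [Formula.eval_sum, ← not_lt, not_iff_not, Finset.sum_pos_iff_of_nonneg
      fun w _ => (eval_comparisonFormula hR θ r w).1]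
    simp only [Finset.mem_univ, true_and, (eval_comparisonFormula hR θ r _).2, batchRejects,
      Prod.exists]
  have hc : (Formula.sum fun r : Fin ρ => (.sub (.const 1) (.le (Formula.sum
      (comparisonFormula N Q M n ρ θ r)) (.const 0)) : AuditFormula N Q M n ρ)).eval x h R =
      (Finset.univ.filter fun r =>
        batchRejects (hypPart h r) (netPart x r) (evalPart x r) θ).card := by
    rw [Formula.eval_sum, Finset.card_filter]
    push_cast
    refine Finset.sum_congr rfl fun r _ => ?_
    simp only [Formula.eval, hs]
    split_ifs <;> simp_all
  rw [verdictFormula, Formula.eval, Formula.eval, Formula.eval, hc]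
  simp only [Formula.eval, Nat.cast_le]
  split_ifs with hk
  · simp [hk]
  · simpa using hk

/-- Register `0` is kept for the answer, so the stored correlations start at `1`; the base
correlations follow the call correlations and the verdict is computed above both. The initial
contents `R₀` are irrelevant because the stored formulas read no registers. -/
lemma decideProgram_spec (θ : ℝ) (k : ℕ) (R₀ : ℕ → ℝ) :
    ∃ R, Loaded x h R ∧ runProgram x h (decideProgram N Q M n ρ θ k) R₀ 0 =
      (verdictFormula N Q M n ρ θ k).eval x h R := by
  have hthr : ∀ b r s, (thresholdFormula N Q M n ρ r s).Below b := by
    intro b r s; cases s <;> trivial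
  have hA : ∀ e ∈ List.ofFn (callFormula N Q M n ρ), e.Below 0 := by
    intro e he
    obtain ⟨j, rfl⟩ := (List.mem_ofFn' ..).1 he
    exact Formula.below_sum fun b => ⟨trivial, trivial, trivial⟩
  have hB : ∀ e ∈ List.ofFn (baseFormula N Q M n ρ), e.Below 0 := by
    intro e he
    obtain ⟨j, rfl⟩ := (List.mem_ofFn' ..).1 he
    exact Formula.below_sum fun b =>
      ⟨⟨⟨trivial, hthr _ _ _, trivial⟩, trivial⟩, trivial, hthr _ _ _⟩
  set b := 1 + ρ * (N * Q) + ρ * (M + N) with hb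
  have hV : (verdictFormula N Q M n ρ θ k).Below b := by
    refine ⟨trivial, trivial, Formula.below_sum fun r => ⟨trivial,
      Formula.below_sum fun w => ?_, trivial⟩⟩
    refine ⟨⟨⟨hthr _ _ _, trivial⟩, trivial, hthr _ _ _⟩, ⟨trivial, ?_⟩, ?_⟩
    · have := ((exampleIndex M N ρ).symm (r, w.2)).isLt
      show _ < b
      omega
    · have := ((callIndex N Q ρ).symm (r, w.1)).isLt
      show _ < b
      omega
  set R₁ := runProgram x h (Formula.compileAll (List.ofFn (callFormula N Q M n ρ)) 1) R₀ with h1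
  set R₂ := runProgram x h (Formula.compileAll (List.ofFn (baseFormula N Q M n ρ))
    (1 + ρ * (N * Q))) R₁ with h2
  obtain ⟨a1, a2⟩ := Formula.compileAll_spec x h _ hA 1 R₀
  obtain ⟨b1, b2⟩ := Formula.compileAll_spec x h _ hB (1 + ρ * (N * Q)) R₁
  obtain ⟨v1, v2⟩ := Formula.compile_spec x h _ b R₂ hV
  refine ⟨R₂, ⟨fun j => ?_, fun u => ?_⟩, ?_⟩
  · have := a1 j (by simp)
    rw [h2, b2 _ (by have := j.isLt; omega), h1, this]
    simp
  · have := b1 u (by simp)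
    rw [h2, this]
    simp
  · rw [decideProgram, Formula.runProgram_append, Formula.runProgram_append,
      Formula.runProgram_append, ← h1, ← h2, ← v1]
    set R₃ := runProgram x h ((verdictFormula N Q M n ρ θ k).compile b) R₂
    have hb0 : b ≠ 0 := by omega
    simp only [runProgram, List.foldl, Instr.exec]
    rw [Function.update_self, Function.update_self, Function.update_of_ne hb0, zero_add]

end evaluation

open Classical in
lemma accepts_auditProcedure_iff {m : ℕ} (AL : Learner.{u} m) (θ : ℝ) (k : ℕ)
    (x : Fin (ρ * (M + n)) → unitInterval × Bool) (d : Fin (ρ * (N * Q)) → CallSample AL) :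
    (auditProcedure N Q M n ρ θ k).Accepts AL (x, d) ↔
      (Finset.univ.filter fun r : Fin ρ => batchRejects
        (batchHyp AL fun c => d ((callIndex N Q ρ).symm (r, c)))
        (netPart x r) (evalPart x r) θ).card < k := by
  set h : Fin (ρ * (N * Q)) → unitInterval → Bool := fun j =>
    callHyp AL (grid N (callIndex N Q ρ j).2.1) (d j) with hh
  have h1 : (fun j => (auditProcedure N Q M n ρ θ k).answer AL x j (d j).1 (d j).2) = h := by
    funext j
    exact answer_auditProcedure AL θ k x j (d j)
  have h2 : (auditProcedure N Q M n ρ θ k).Accepts AL (x, d) ↔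
      0 < runProgram x h (decideProgram N Q M n ρ θ k)
        ((auditProcedure N Q M n ρ θ k).prepared x) 0 := by
    rw [← h1]; rfl
  obtain ⟨R, hR, e⟩ := decideProgram_spec (x := x) (h := h) θ k
    ((auditProcedure N Q M n ρ θ k).prepared x)
  rw [h2, e, eval_verdictFormula hR]
  have h3 : ∀ r, hypPart h r = batchHyp AL fun c => d ((callIndex N Q ρ).symm (r, c)) := by
    intro r
    funext c
    simp only [hypPart, hh, batchHyp, Equiv.apply_symm_apply]
  simp only [h3]

/-- The number of operations of the audit procedure. -/
lemma ops_auditProcedure_le (θ : ℝ) (k : ℕ) :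
    (auditProcedure N Q M n ρ θ k).ops ≤ 2 * N + ρ * (N * Q) * (n * 7 + 1) +
      ρ * (M + N) * (n * 12 + 1) + (ρ * (N * Q * (M + N) * 16 + 6) + 7) := by
  have hthr : ∀ r s, (thresholdFormula N Q M n ρ r s).cost = 1 := by
    intro r s; cases s <;> rfl
  have hp : (prepareProgram N M n ρ).length ≤ 2 * N := by
    have : ∀ y, ∀ e ∈ List.ofFn fun i : Fin N =>
        (Formula.const (labelProb (grid N i) y) : Formula (ρ * (M + n)) 0), e.cost ≤ 1 := by
      intro y e he
      obtain ⟨i, rfl⟩ := (List.mem_ofFn' ..).1 he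
      exact le_rfl
    have h1 := Formula.length_compileAll_le (this true) 0
    have h2 := Formula.length_compileAll_le (this false) N
    simp only [List.length_ofFn] at h1 h2
    rw [prepareProgram, List.length_append]
    omega
  have hA : ∀ e ∈ List.ofFn (callFormula N Q M n ρ), e.cost ≤ n * 7 + 1 := by
    intro e he
    obtain ⟨j, rfl⟩ := (List.mem_ofFn' ..).1 he
    refine (Formula.cost_sum_le (c := 6) fun b => ?_).trans (by simp)
    simp [Formula.cost]
  have hB : ∀ e ∈ List.ofFn (baseFormula N Q M n ρ), e.cost ≤ n * 12 + 1 := by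
    intro e he
    obtain ⟨j, rfl⟩ := (List.mem_ofFn' ..).1 he
    refine (Formula.cost_sum_le (c := 11) fun b => ?_).trans (by simp)
    simp [Formula.cost, hthr]
  have hV : (verdictFormula N Q M n ρ θ k).cost ≤ ρ * (N * Q * (M + N) * 16 + 6) + 5 := by
    have h1 : ∀ r : Fin ρ, (Formula.sum (comparisonFormula N Q M n ρ θ r)).cost ≤
        N * Q * (M + N) * 16 + 1 := by
      intro r
      refine (Formula.cost_sum_le (c := 15) fun w => ?_).trans (by simp)
      simp [Formula.cost, comparisonFormula, hthr]
    have h2 := Formula.cost_sum_le (c := N * Q * (M + N) * 16 + 5)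
      (f := fun r : Fin ρ => (.sub (.const 1) (.le (Formula.sum
        (comparisonFormula N Q M n ρ θ r)) (.const 0)) : AuditFormula N Q M n ρ))
      (fun r => by have := h1 r; simp only [Formula.cost]; omega)
    simp only [Fintype.card_fin] at h2
    rw [show N * Q * (M + N) * 16 + 5 + 1 = N * Q * (M + N) * 16 + 6 from rfl] at h2
    simp only [verdictFormula, Formula.cost]
    omega
  have hd : (decideProgram N Q M n ρ θ k).length ≤ ρ * (N * Q) * (n * 7 + 1) +
      ρ * (M + N) * (n * 12 + 1) + (ρ * (N * Q * (M + N) * 16 + 6) + 7) := by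
    have h1 := Formula.length_compileAll_le hA 1
    have h2 := Formula.length_compileAll_le hB (1 + ρ * (N * Q))
    simp only [List.length_ofFn] at h1 h2
    simp only [decideProgram, List.length_append, Formula.length_compile, List.length_cons,
      List.length_nil]
    omega
  have : (auditProcedure N Q M n ρ θ k).ops =
      (prepareProgram N M n ρ).length + (decideProgram N Q M n ρ θ k).length := rfl
  rw [this]
  omega

end

/-! ### Majority vote over independent batches -/

variable {m N Q M n k : ℕ}

/-- The part of a run that belongs to batch `r`. -/
def batchOf (AL : Learner.{u} m)
    (s : (Fin (2 * k * (M + n)) → unitInterval × Bool) ×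
      (Fin (2 * k * (N * Q)) → CallSample AL)) (r : Fin (2 * k)) :
    Batch N Q M n (CallSample AL) :=
  ((netPart s.1 r, fun c => s.2 ((callIndex N Q (2 * k)).symm (r, c))), evalPart s.1 r)

-- The run is regrouped into `2k` i.i.d. batches, to which `majority_bound` applies.
open Classical in
lemma law_many_bad_le (AL : Learner.{u} m) (J : Measure (unitInterval × Bool))
    [IsProbabilityMeasure J] (θ : ℝ) {c : ENNReal} {bad : Set (Batch N Q M n (CallSample AL))}
    (hbad : 4 * batchLaw N Q M n J (callLaw AL J) bad ≤ c) :
    (auditProcedure N Q M n (2 * k) θ k).law AL J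
      {s | k ≤ (Finset.univ.filter fun r => batchOf AL s r ∈ bad).card} ≤ c ^ k := by
  have h1 := measurePreserving_batches J (callLaw AL J) (exampleIndex M n (2 * k))
    (callIndex N Q (2 * k))
  exact (measure_preimage_le_of_preserving h1
    {b | k ≤ (Finset.univ.filter fun r => b r ∈ bad).card}).trans
      (majority_bound (batchLaw N Q M n J (callLaw AL J)) hbad k)

/-- Subadditivity alone is used, so the acceptance event need not be measurable. -/
lemma one_sub_le_measureReal {A : Type*} [MeasurableSpace A] (μ : Measure A)
    [IsProbabilityMeasure μ] {s t : Set A} (hst : sᶜ ⊆ t) {δ : ℝ} (hδ : 0 ≤ δ)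
    (ht : μ t ≤ ENNReal.ofReal δ) : 1 - δ ≤ μ.real s := by
  have h1 : μ.real t ≤ δ := ENNReal.toReal_le_of_le_ofReal hδ ht
  have h2 : μ.real Set.univ ≤ μ.real s + μ.real t :=
    (measureReal_mono (fun x _ => by
      by_cases hx : x ∈ s
      · exact Or.inl hx
      · exact Or.inr (hst hx))).trans (measureReal_union_le s t)
  rw [probReal_univ] at h2
  linarith

instance (A : Procedure) (AL : Learner.{u} m) (J : Measure (unitInterval × Bool))
    [IsProbabilityMeasure J] : IsProbabilityMeasure (A.law AL J) := by
  unfold Procedure.law; infer_instance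

lemma accepts_prob (AL : Learner.{u} m) (J : Measure (unitInterval × Bool))
    [IsProbabilityMeasure J] (θ : ℝ) {c : ENNReal} {δ : ℝ} (hδ : 0 ≤ δ)
    (hc : c ^ k ≤ ENNReal.ofReal δ)
    (hbad : 4 * batchLaw N Q M n J (callLaw AL J)
      {b | batchRejects (batchHyp AL b.1.2) b.1.1 b.2 θ} ≤ c) :
    1 - δ ≤ ((auditProcedure N Q M n (2 * k) θ k).law AL J).real
      {s | (auditProcedure N Q M n (2 * k) θ k).Accepts AL s} := by
  classical
  refine one_sub_le_measureReal _ (fun s hs => ?_) hδ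
    ((law_many_bad_le (k := k) AL J θ hbad).trans hc)
  have hs' : ¬ (auditProcedure N Q M n (2 * k) θ k).Accepts AL (s.1, s.2) := hs
  exact not_lt.1 (mt (accepts_auditProcedure_iff AL θ k s.1 s.2).2 hs')

lemma rejects_prob (AL : Learner.{u} m) (J : Measure (unitInterval × Bool))
    [IsProbabilityMeasure J] (θ : ℝ) {c : ENNReal} {δ : ℝ} (hδ : 0 ≤ δ)
    (hc : c ^ k ≤ ENNReal.ofReal δ)
    (hbad : 4 * batchLaw N Q M n J (callLaw AL J)
      {b | ¬ batchRejects (batchHyp AL b.1.2) b.1.1 b.2 θ} ≤ c) :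
    1 - δ ≤ ((auditProcedure N Q M n (2 * k) θ k).law AL J).real
      {s | ¬ (auditProcedure N Q M n (2 * k) θ k).Accepts AL s} := by
  classical
  refine one_sub_le_measureReal _ (fun s hs => ?_) hδ
    ((law_many_bad_le (k := k) AL J θ hbad).trans hc)
  have hs' : (auditProcedure N Q M n (2 * k) θ k).Accepts AL (s.1, s.2) := not_not.1 hs
  have hlt := (accepts_auditProcedure_iff AL θ k s.1 s.2).1 hs'
  -- If fewer than `k` of the `2k` batches reject, at least `k` fail to reject, so wrong acceptance
  -- is also covered by the vote.
  have h1 := Finset.card_filter_add_card_filter_not (s := (Finset.univ : Finset (Fin (2 * k))))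
    (fun r => batchRejects (batchHyp AL fun c => s.2 ((callIndex N Q (2 * k)).symm (r, c)))
        (netPart s.1 r) (evalPart s.1 r) θ)
  rw [Finset.card_univ, Fintype.card_fin] at h1
  have h2 : k ≤ (Finset.univ.filter fun r => ¬ batchRejects (batchHyp AL fun c =>
    s.2 ((callIndex N Q (2 * k)).symm (r, c))) (netPart s.1 r) (evalPart s.1 r) θ).card := by
    omega
  show k ≤ Finset.card _
  convert h2 <;> rfl

/-- Suitable parameters make the audit procedure an auditor, and a tester for proper learners. -/
lemma auditProcedure_correct {α ε δ : ℝ} (hα : 0 ≤ α) (hε : 0 < ε) (hδ : 0 ≤ δ) (hn : 0 < n)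
    (hN : 0 < N) (hNε : 1 / (N : ℝ) ≤ ε / 12)
    (hfail : 4 * batchFailure N Q M n ε ≤ ENNReal.ofReal ε)
    (hk : ENNReal.ofReal ε ^ k ≤ ENNReal.ofReal δ)
    {K : Set (unitInterval → unitInterval)} (hK : IsValidClass K) (hKm : ∀ κ ∈ K, Measurable κ)
    (AL : Learner.{u} m) (hAL : AL.IsAgnostic ε (thr K)) :
    (auditProcedure N Q M n (2 * k) (α - 21 / 8 * ε) k).IsAuditor AL K α (α - 3 * ε) δ ∧
      (AL.IsProper (thr K) →
        (auditProcedure N Q M n (2 * k) (α - 21 / 8 * ε) k).IsTester AL K α (α - 3 * ε) δ) := by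
  have hreject : ∀ J : Measure (unitInterval × Bool), IsProbabilityMeasure J → α < CDL K J →
      1 - δ ≤ ((auditProcedure N Q M n (2 * k) (α - 21 / 8 * ε) k).law AL J).real
        {s | ¬ (auditProcedure N Q M n (2 * k) (α - 21 / 8 * ε) k).Accepts AL s} := by
    intro J hJ hlt
    obtain ⟨κ, hκ, w, hw⟩ := exists_gain_gt_of_lt_CDL hK hKm J hα hlt
    simp only [← signVal_decide_le] at hw
    have hf : Measurable (fun p => decide (w ≤ κ p)) :=
      measurable_to_bool (by
        have : (fun p => decide (w ≤ κ p)) ⁻¹' {true} = κ ⁻¹' Set.Ici w := by ext p; simp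
        rw [this]
        exact hKm κ hκ measurableSet_Ici)
    exact rejects_prob AL J _ hδ hk ((mul_le_mul_right (batch_accepts_bad_le AL J hε hn hN hNε hAL
      hf (threshold_mem_thr hK hκ w) hw) 4).trans hfail)
  have haccept : ∀ J : Measure (unitInterval × Bool), IsProbabilityMeasure J →
      (∀ (v : ℝ) (c : CallSample AL) (t : unitInterval),
        gain J (fun p => signVal (callHyp AL v c p)) (Set.Ici t) t ≤ α - 3 * ε) →
      1 - δ ≤ ((auditProcedure N Q M n (2 * k) (α - 21 / 8 * ε) k).law AL J).real
        {s | (auditProcedure N Q M n (2 * k) (α - 21 / 8 * ε) k).Accepts AL s} := by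
    intro J hJ hgain
    exact accepts_prob AL J _ hδ hk
      ((mul_le_mul_right (batch_rejects_bad_le AL J hε hn hNε hgain) 4).trans hfail)
  refine ⟨fun J hJ => ⟨hreject J hJ, fun h => haccept J hJ fun v c t => ?_⟩,
    fun hprop J hJ => ⟨hreject J hJ, fun h => haccept J hJ fun v c t => ?_⟩⟩
  · have := gain_le_ECE J (measurable_signVal.comp (measurable_callHyp_apply AL v c))
      (fun p => (abs_signVal _).le) t
    refine le_trans this ?_
    linarith
  · exact (gain_le_CDL_of_mem_thr hK J (hprop _ _) t).trans h

/-- The procedure that rejects without looking at anything. -/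
def rejectProcedure : Procedure where
  extra := 0
  calls := 0
  prepare := []
  prob j := j.elim0
  decide := []

/-- When `α - 3ε` is negative no distribution has to be accepted, since both error measures are
nonnegative. -/
lemma rejectProcedure_correct {α ε δ : ℝ} (hδ : 0 ≤ δ) (h : α - 3 * ε < 0)
    {K : Set (unitInterval → unitInterval)} (hK : IsValidClass K) (AL : Learner.{u} m) :
    rejectProcedure.IsAuditor AL K α (α - 3 * ε) δ ∧
      rejectProcedure.IsTester AL K α (α - 3 * ε) δ := by
  have hrej : ∀ J : Measure (unitInterval × Bool), IsProbabilityMeasure J →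
      1 - δ ≤ (rejectProcedure.law AL J).real {s | ¬ rejectProcedure.Accepts AL s} := by
    intro J hJ
    refine one_sub_le_measureReal _ (t := ∅) (fun s hs => ?_) hδ (by simp)
    exact hs (lt_irrefl (0 : ℝ))
  refine ⟨fun J hJ => ⟨fun _ => hrej J hJ, fun h' => ?_⟩,
    fun J hJ => ⟨fun _ => hrej J hJ, fun h' => ?_⟩⟩
  · linarith [ECE_nonneg J]
  · linarith [CDL_nonneg hK J]

/-! ### The choice of the parameters -/

/-- The constants make the three contributions at most `ε^5`, `ε^4` (using `e² ≤ 10`) and `186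
ε^10`. In the last, `ε^12` from Hoeffding absorbs the `93/ε²` estimates of the union bound. -/
lemma batchFailure_le {ε : ℝ} (hε : 0 < ε) (hε3 : ε < 1 / 3)
    (hN : (N : ℝ) ≤ 13 / ε) (hQ : 2 * Real.log (1 / ε) ≤ Q) (hQ' : (Q : ℝ) ≤ 3 / ε)
    (hM : 40 * Real.log (1 / ε) / ε ≤ M) (hM' : (M : ℝ) ≤ 41 / ε ^ 2)
    (hn : 6144 * Real.log (1 / ε) / ε ^ 2 ≤ n) :
    4 * batchFailure N Q M n ε ≤ ENNReal.ofReal ε := by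
  set ℓ := Real.log (1 / ε) with hℓ
  have hpow : ∀ j : ℕ, Real.exp (-(j * ℓ)) = ε ^ j := by
    intro j
    rw [hℓ, one_div, Real.log_inv, mul_neg, neg_neg, Real.exp_nat_mul, Real.exp_log hε]
  have h1 : Real.exp (-(ε / 8 * M)) ≤ ε ^ 5 := by
    rw [← hpow]
    apply Real.exp_le_exp.2
    rw [div_le_iff₀ hε] at hM
    push_cast
    linarith
  have h2 : (1 / 10 : ℝ) ^ Q ≤ ε ^ 4 := by
    have e1 : (1 / 10 : ℝ) ≤ Real.exp (-2) := by
      have : Real.exp 2 ≤ 10 := by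
        have h := Real.exp_one_lt_d9
        have e : Real.exp 2 = Real.exp 1 * Real.exp 1 := by rw [← Real.exp_add]; norm_num
        have := Real.exp_pos 1
        rw [e]; nlinarith
      rw [Real.exp_neg, ← one_div]
      exact one_div_le_one_div_of_le (Real.exp_pos _) this
    calc (1 / 10 : ℝ) ^ Q ≤ Real.exp (-2) ^ Q := pow_le_pow_left₀ (by norm_num) e1 Q
      _ = Real.exp (Q * (-2)) := (Real.exp_nat_mul _ _).symm
      _ ≤ Real.exp (-((4 : ℕ) * ℓ)) := Real.exp_le_exp.2 (by push_cast; linarith)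
      _ = ε ^ 4 := hpow 4
  have h3 : Real.exp (-(n * (ε / 16) ^ 2 / 2)) ≤ ε ^ 12 := by
    rw [← hpow]
    apply Real.exp_le_exp.2
    rw [div_le_iff₀ (by positivity)] at hn
    push_cast
    nlinarith
  have h4 : ((N * Q + (M + N) : ℕ) : ℝ) ≤ 93 / ε ^ 2 := by
    push_cast
    have a : (N : ℝ) * Q ≤ 13 / ε * (3 / ε) :=
      mul_le_mul hN hQ' (Nat.cast_nonneg _) (by positivity)
    have b : 13 / ε ≤ 13 / ε ^ 2 := by
      apply div_le_div_of_nonneg_left (by norm_num) (by positivity)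
      nlinarith
    have c : 13 / ε * (3 / ε) = 39 / ε ^ 2 := by field_simp; norm_num
    have d : 93 / ε ^ 2 = 39 / ε ^ 2 + (41 / ε ^ 2 + 13 / ε ^ 2) := by ring
    linarith
  have h5 : ((N * Q + (M + N) : ℕ) : ℝ) * (2 * Real.exp (-(n * (ε / 16) ^ 2 / 2))) ≤
      186 * ε ^ 10 := by
    calc _ ≤ 93 / ε ^ 2 * (2 * ε ^ 12) := mul_le_mul h4 (by linarith)
            (by positivity) (by positivity)
      _ = 186 * ε ^ 10 := by field_simp; norm_num
  have e : batchFailure N Q M n ε = ENNReal.ofReal (Real.exp (-(ε / 8 * M)) + (1 / 10) ^ Q +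
      ((N * Q + (M + N) : ℕ) : ℝ) * (2 * Real.exp (-(n * (ε / 16) ^ 2 / 2)))) := by
    rw [ENNReal.ofReal_add (by positivity) (by positivity),
      ENNReal.ofReal_add (by positivity) (by positivity), ENNReal.ofReal_mul (by positivity),
      ENNReal.ofReal_natCast, ENNReal.ofReal_pow (by positivity), batchFailure]
  have p3 : ε ^ 3 ≤ 1 / 27 := by
    calc ε ^ 3 ≤ (1 / 3) ^ 3 := pow_le_pow_left₀ hε.le hε3.le 3
      _ = 1 / 27 := by norm_num
  have p4 : ε ^ 4 ≤ 1 / 81 := by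
    calc ε ^ 4 ≤ (1 / 3) ^ 4 := pow_le_pow_left₀ hε.le hε3.le 4
      _ = 1 / 81 := by norm_num
  have p9 : ε ^ 9 ≤ 1 / 19683 := by
    calc ε ^ 9 ≤ (1 / 3) ^ 9 := pow_le_pow_left₀ hε.le hε3.le 9
      _ = 1 / 19683 := by norm_num
  have h4' : (4 : ENNReal) = ENNReal.ofReal 4 := by norm_num
  rw [e, h4', ← ENNReal.ofReal_mul (by norm_num)]
  apply ENNReal.ofReal_le_ofReal
  have q3 := mul_le_mul_of_nonneg_left p3 hε.le
  have q4 := mul_le_mul_of_nonneg_left p4 hε.le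
  have q9 := mul_le_mul_of_nonneg_left p9 hε.le
  have r3 : ε * ε ^ 3 = ε ^ 4 := by ring
  have r4 : ε * ε ^ 4 = ε ^ 5 := by ring
  have r9 : ε * ε ^ 9 = ε ^ 10 := by ring
  rw [r3] at q3
  rw [r4] at q4
  rw [r9] at q9
  linarith

lemma ceil_le_mul_of_one_le {a x : ℝ} (ha : 0 ≤ a) (hx : 1 ≤ x) :
    (⌈a * x⌉₊ : ℝ) ≤ (a + 1) * x := by
  have := Nat.ceil_lt_add_one (mul_nonneg ha (zero_le_one.trans hx))
  linarith

lemma resource_bounds {x ℓ L : ℝ} (hx : 1 ≤ x) (hℓ : 1 ≤ ℓ) (hkℓ : k * ℓ ≤ L) (hk : 1 ≤ k)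
    (hN0 : 1 ≤ N) (hn0 : 1 ≤ n) (hN : (N : ℝ) ≤ 13 * x) (hQ : (Q : ℝ) ≤ 3 * ℓ)
    (hM : (M : ℝ) ≤ 41 * (ℓ * x)) (hn : (n : ℝ) ≤ 6145 * (ℓ * x ^ 2)) :
    ((2 * k * (N * Q) : ℕ) : ℝ) ≤ 13000000 * x * L ∧
    ((2 * k * (M + n) : ℕ) : ℝ) ≤ 13000000 * x ^ 2 * L ∧
    ((2 * N + 2 * k * (N * Q) * (n * 7 + 1) + 2 * k * (M + N) * (n * 12 + 1) +
      (2 * k * (N * Q * (M + N) * 16 + 6) + 7) : ℕ) : ℝ) ≤ 13000000 * (L * x ^ 3) * ℓ := by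
  have hx0 : 0 ≤ x := by linarith
  have hℓ0 : 0 ≤ ℓ := by linarith
  have hk0 : (0 : ℝ) ≤ k := Nat.cast_nonneg _
  have hk1 : (1 : ℝ) ≤ k := by exact_mod_cast hk
  have hn1 : (1 : ℝ) ≤ n := by exact_mod_cast hn0
  have hx2 : x ≤ x ^ 2 := by nlinarith
  have hx23 : x ^ 2 ≤ x ^ 3 := by nlinarith [sq_nonneg x]
  have hx3 : 1 ≤ x ^ 3 := by linarith
  have hL0 : 0 ≤ L := (mul_nonneg hk0 hℓ0).trans hkℓ
  have hNQ : (N : ℝ) * Q ≤ 39 * (ℓ * x) := by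
    calc (N : ℝ) * Q ≤ 13 * x * (3 * ℓ) := mul_le_mul hN hQ (Nat.cast_nonneg _) (by positivity)
      _ = _ := by ring
  have hMN : (M : ℝ) + N ≤ 54 * (ℓ * x) := by
    have : 1 * x ≤ ℓ * x := mul_le_mul_of_nonneg_right hℓ hx0
    linarith
  have hℓℓ : ℓ ≤ ℓ ^ 2 := by nlinarith
  refine ⟨?_, ?_, ?_⟩
  · push_cast
    calc 2 * (k : ℝ) * (N * Q) ≤ 2 * k * (39 * (ℓ * x)) := by gcongr
      _ = 78 * x * (k * ℓ) := by ring
      _ ≤ 78 * x * L := by gcongr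
      _ ≤ 13000000 * x * L := by gcongr; norm_num
  · push_cast
    have h1 : (M : ℝ) + n ≤ 6186 * (ℓ * x ^ 2) := by
      have : ℓ * x ≤ ℓ * x ^ 2 := mul_le_mul_of_nonneg_left hx2 hℓ0
      linarith
    calc 2 * (k : ℝ) * (M + n) ≤ 2 * k * (6186 * (ℓ * x ^ 2)) := by gcongr
      _ = 12372 * x ^ 2 * (k * ℓ) := by ring
      _ ≤ 12372 * x ^ 2 * L := by gcongr
      _ ≤ 13000000 * x ^ 2 * L := by gcongr; norm_num
  · push_cast
    -- The common scale of all operation counts: `N Q n` and `(M + N) n` have order `ℓ² x³`, while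
    -- the comparisons need only `ℓ² x²`.
    set T : ℝ := k * ℓ ^ 2 * x ^ 3 with hT
    have hℓ2 : 1 ≤ ℓ ^ 2 := by linarith
    have hkℓ2 : (1 : ℝ) ≤ k * ℓ ^ 2 := one_le_mul_of_one_le_of_one_le hk1 hℓ2
    have t1 : 1 ≤ T := one_le_mul_of_one_le_of_one_le hkℓ2 hx3
    have t2 : 2 * (N : ℝ) ≤ 26 * T := by
      have : 1 * x ^ 3 ≤ k * ℓ ^ 2 * x ^ 3 := mul_le_mul_of_nonneg_right hkℓ2 (by positivity)
      linarith
    have t3 : 2 * (k : ℝ) * (N * Q) * (n * 7 + 1) ≤ 3834480 * T := by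
      calc 2 * (k : ℝ) * (N * Q) * (n * 7 + 1) ≤
            2 * k * (39 * (ℓ * x)) * (8 * (6145 * (ℓ * x ^ 2))) := by
            gcongr; linarith
        _ = 3834480 * T := by rw [hT]; ring
    have t4 : 2 * (k : ℝ) * (M + N) * (n * 12 + 1) ≤ 8627580 * T := by
      calc 2 * (k : ℝ) * (M + N) * (n * 12 + 1) ≤
            2 * k * (54 * (ℓ * x)) * (13 * (6145 * (ℓ * x ^ 2))) := by
            gcongr; linarith
        _ = 8627580 * T := by rw [hT]; ring
    have t5 : 2 * (k : ℝ) * (N * Q * (M + N) * 16 + 6) ≤ 67404 * T := by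
      have a : (N : ℝ) * Q * (M + N) ≤ 39 * (ℓ * x) * (54 * (ℓ * x)) := by gcongr
      have b : (ℓ * x) * (ℓ * x) ≤ ℓ ^ 2 * x ^ 3 := by
        have : ℓ ^ 2 * x ^ 2 ≤ ℓ ^ 2 * x ^ 3 := mul_le_mul_of_nonneg_left hx23 (by positivity)
        linarith
      have c : 1 ≤ ℓ ^ 2 * x ^ 3 := one_le_mul_of_one_le_of_one_le hℓ2 hx3
      calc 2 * (k : ℝ) * (N * Q * (M + N) * 16 + 6) ≤
            2 * k * (33702 * (ℓ ^ 2 * x ^ 3)) := by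
            gcongr; linarith
        _ = 67404 * T := by rw [hT]; ring
    have t6 : T ≤ L * x ^ 3 * ℓ := by
      calc T = k * ℓ * (x ^ 3 * ℓ) := by rw [hT]; ring
        _ ≤ L * (x ^ 3 * ℓ) := by gcongr
        _ = _ := by ring
    linarith

end

end CalDec

theorem mainTheorem3 :
    ∃ C : ℝ, 0 < C ∧ ∃ k : ℕ, ∀ α ∈ Set.Ioo (0 : ℝ) 1, ∀ ε ∈ Set.Ioo (0 : ℝ) 1,
      ∀ δ ∈ Set.Ioo (0 : ℝ) 1, ∃ A : CalDec.Procedure,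
        (A.calls : ℝ) ≤ C * (1 / ε) * Real.log (1 / (ε * δ)) ∧
        (A.extra : ℝ) ≤ C * (1 / ε ^ 2) * Real.log (1 / (ε * δ)) ∧
        (A.ops : ℝ) ≤ C * (Real.log (1 / (ε * δ)) / ε ^ 3) *
          Real.log (2 + Real.log (1 / (ε * δ)) / ε ^ 3) ^ k ∧
        ∀ K : Set (unitInterval → unitInterval), CalDec.IsValidClass K →
          (∀ κ ∈ K, Measurable κ) →
          ∀ (m : ℕ) (AL : CalDec.Learner.{u} m), AL.IsAgnostic ε (CalDec.thr K) →
            A.IsAuditor AL K α (α - 3 * ε) δ ∧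
            (AL.IsProper (CalDec.thr K) → A.IsTester AL K α (α - 3 * ε) δ) := by
  -- One logarithmic factor suffices; the constant is dominated by the coefficients of `T` in
  -- `resource_bounds`.
  refine ⟨13000000, by norm_num, 1, fun α hα ε hε δ hδ => ?_⟩
  obtain ⟨hα0, hα1⟩ := hα
  obtain ⟨hε0, hε1⟩ := hε
  obtain ⟨hδ0, hδ1⟩ := hδ
  set L := Real.log (1 / (ε * δ)) with hL
  have hLsum : L = Real.log (1 / ε) + Real.log (1 / δ) := by
    rw [hL, one_div, mul_inv, Real.log_mul (by positivity) (by positivity), one_div, one_div]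
  have hlogε : 0 < Real.log (1 / ε) := Real.log_pos (one_lt_one_div hε0 hε1)
  have hlogδ : 0 < Real.log (1 / δ) := Real.log_pos (one_lt_one_div hδ0 hδ1)
  have hL0 : 0 < L := by linarith
  -- For `ε ≥ 1/3` one has `α - 3ε < 0`, and always rejecting is correct. Below `1/3`, `1/ε > e`
  -- gives `ℓ ≥ 1`, which the resource bounds need.
  rcases le_or_gt (1 / 3) ε with h3 | h3
  · refine ⟨CalDec.rejectProcedure, ?_, ?_, ?_, fun K hK _ m AL _ => ?_⟩
    · simp only [CalDec.rejectProcedure, Nat.cast_zero]; positivity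
    · simp only [CalDec.rejectProcedure, Nat.cast_zero]; positivity
    · have h0 : (CalDec.rejectProcedure.ops : ℝ) = 0 := by
        simp [CalDec.rejectProcedure, CalDec.Procedure.ops]
      rw [h0]
      have : 0 ≤ Real.log (2 + L / ε ^ 3) := Real.log_nonneg (by
        have : 0 ≤ L / ε ^ 3 := by positivity
        linarith)
      positivity
    · have := CalDec.rejectProcedure_correct (α := α) (ε := ε) hδ0.le (by linarith) hK AL
      exact ⟨this.1, fun _ => this.2⟩
  · set ℓ := Real.log (1 / ε) with hℓ
    set x := 1 / ε with hx
    have hx3 : 3 < x := by rw [hx, lt_div_iff₀ hε0]; linarith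
    have hx0 : 0 < x := by linarith
    have hx1 : 1 ≤ x := by linarith
    have hℓ1 : 1 ≤ ℓ := by
      rw [hℓ, Real.le_log_iff_exp_le hx0]
      have := Real.exp_one_lt_d9
      linarith
    have hℓ0 : 0 < ℓ := by linarith
    have hℓx : ℓ ≤ x := by
      have := Real.log_le_sub_one_of_pos hx0
      linarith
    set N := ⌈12 * x⌉₊ with hN
    set Q := ⌈2 * ℓ⌉₊ with hQ
    set M := ⌈40 * (ℓ * x)⌉₊ with hM
    set n := ⌈6144 * (ℓ * x ^ 2)⌉₊ with hn
    -- The least `k` with `ε^k ≤ δ`; rounding up costs one `ℓ`, so `k * ℓ ≤ log (1/δ) + ℓ = L`.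
    set k := ⌈Real.log (1 / δ) / ℓ⌉₊ with hk
    have hℓx1 : 1 ≤ ℓ * x := one_le_mul_of_one_le_of_one_le hℓ1 hx1
    have hℓx2 : 1 ≤ ℓ * x ^ 2 := one_le_mul_of_one_le_of_one_le hℓ1 (one_le_pow₀ hx1)
    have bN : (N : ℝ) ≤ 13 * x :=
      (CalDec.ceil_le_mul_of_one_le (by norm_num) hx1).trans_eq (by norm_num)
    have bQ : (Q : ℝ) ≤ 3 * ℓ :=
      (CalDec.ceil_le_mul_of_one_le (by norm_num) hℓ1).trans_eq (by norm_num)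
    have bM : (M : ℝ) ≤ 41 * (ℓ * x) :=
      (CalDec.ceil_le_mul_of_one_le (by norm_num) hℓx1).trans_eq (by norm_num)
    have bn : (n : ℝ) ≤ 6145 * (ℓ * x ^ 2) :=
      (CalDec.ceil_le_mul_of_one_le (by norm_num) hℓx2).trans_eq (by norm_num)
    have aN := Nat.le_ceil (12 * x)
    have aQ := Nat.le_ceil (2 * ℓ)
    have aM := Nat.le_ceil (40 * (ℓ * x))
    have an := Nat.le_ceil (6144 * (ℓ * x ^ 2))
    have N0 : 0 < N := Nat.ceil_pos.2 (by positivity)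
    have n0 : 0 < n := Nat.ceil_pos.2 (by positivity)
    have k0 : 0 < k := Nat.ceil_pos.2 (by positivity)
    have hkℓ : k * ℓ ≤ L := by
      have h1 := Nat.ceil_lt_add_one (div_nonneg hlogδ.le hℓ0.le)
      have h2 : (k : ℝ) * ℓ ≤ (Real.log (1 / δ) / ℓ + 1) * ℓ :=
        mul_le_mul_of_nonneg_right h1.le hℓ0.le
      rw [add_mul, div_mul_cancel₀ _ hℓ0.ne'] at h2
      linarith
    have hkδ : ENNReal.ofReal ε ^ k ≤ ENNReal.ofReal δ := by
      rw [← ENNReal.ofReal_pow hε0.le]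
      apply ENNReal.ofReal_le_ofReal
      have h1 : Real.log (1 / δ) ≤ k * ℓ := by
        rw [← div_le_iff₀ hℓ0]; exact Nat.le_ceil _
      rw [← Real.log_le_log_iff (by positivity) hδ0, Real.log_pow]
      have e1 : Real.log ε = -ℓ := by rw [hℓ, hx, one_div, Real.log_inv, neg_neg]
      rw [one_div, Real.log_inv] at h1
      rw [e1]
      linarith
    have hNε : 1 / (N : ℝ) ≤ ε / 12 := by
      rw [div_le_div_iff₀ (by exact_mod_cast N0) (by norm_num)]
      have : 12 * x * ε ≤ N * ε := mul_le_mul_of_nonneg_right aN hε0.le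
      rw [mul_assoc, hx, one_div_mul_cancel hε0.ne'] at this
      linarith
    have hfail : 4 * CalDec.batchFailure N Q M n ε ≤ ENNReal.ofReal ε := by
      refine CalDec.batchFailure_le hε0 h3 (bN.trans_eq ?_) aQ ?_ (le_trans (le_of_eq ?_) aM) ?_
        (le_trans (le_of_eq ?_) an)
      · rw [hx]; ring
      · calc (Q : ℝ) ≤ 3 * x := bQ.trans (by linarith)
          _ = 3 / ε := by rw [hx]; ring
      · rw [hx]; ring
      · calc (M : ℝ) ≤ 41 * (x * x) := bM.trans (by gcongr)
          _ = 41 / ε ^ 2 := by rw [hx]; field_simp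
      · rw [hx]; ring
    obtain ⟨r1, r2, r3⟩ := CalDec.resource_bounds (M := M) hx1 hℓ1 hkℓ k0 N0 n0 bN bQ bM bn
    have hx2 : 1 / ε ^ 2 = x ^ 2 := by rw [hx]; ring
    have hx3' : L / ε ^ 3 = L * x ^ 3 := by rw [hx]; field_simp
    refine ⟨CalDec.auditProcedure N Q M n (2 * k) (α - 21 / 8 * ε) k, r1, ?_, ?_,
      fun K hK hKm m AL hAL => CalDec.auditProcedure_correct hα0.le hε0 hδ0.le n0 N0 hNε hfail hkδ
        hK hKm AL hAL⟩
    · rw [hx2]; exact r2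
    · rw [hx3', pow_one]
      -- The surplus factor `ℓ` in the operation count is absorbed by the logarithm allowed in the
      -- statement, since `1/ε ≤ L/ε³`.
      have h1 : ℓ ≤ Real.log (2 + L * x ^ 3) := by
        rw [hℓ]
        apply Real.log_le_log hx0
        have a : x ≤ x ^ 3 := le_self_pow₀ hx1 (by norm_num)
        have b : 1 * x ^ 3 ≤ L * x ^ 3 := mul_le_mul_of_nonneg_right (by linarith) (by positivity)
        linarith
      have h2 := CalDec.ops_auditProcedure_le (N := N) (Q := Q) (M := M) (n := n) (ρ := 2 * k)
        (α - 21 / 8 * ε) k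
      have h2' := (Nat.cast_le (α := ℝ)).2 h2
      refine (h2'.trans r3).trans ?_
      gcongr
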